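/- Let $F=\mathbf Z/2$, let $N\ge 3$ be odd, and let $V$ be an $F$-vector space with an alternating bilinear form $\langle\,,\rangle$ and a basis $(e_s)_{s\in S}$ such that the graph on $S$ in which $s\ne s'$ are joined exactly when $\langle e_s,e_{s'}\rangle=1$ is a cycle with $N$ vertices (affine type $A_{N-1}$). For $I\subseteq S$ put $e_I=\sum_{s\in I}e_s$. Let $\bar V=V/Fe_S$ with the induced form, let $\bar e_s$ be the image of $e_s$ in $\bar V$, and put $\bar e_I=\sum_{s\in I}\bar e_s$. Let $\mathcal I$ be the set of all $I\subseteq S$ whose full subgraph is a path with $m\ge1$ vertices, and let $\mathcal I^0$ (resp. $\mathcal I^1$) be the set of $I\in\mathcal I$ with $|I|$ even (resp. odd). For $I,I'\in\mathcal I^1$ write $I\prec I'$ if $I\subsetneq I'$ and the full subgraph on $I'\setminus I$ is disconnected, and $I\spadesuit I'$ if $I\cap I'=\emptyset$ and the full subgraph on $I\cup I'$ is disconnected. For $I\in\mathcal I^1$ let $I^{ev}$ be the set of all $s\in I$ such that $I\setminus\{s\}=I'\sqcup I''$ with $I',I''\in\mathcal I^1$ and $I'\spadesuit I''$. Let $\varphi(\bar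 V)$ be the set of all subsets $B\subseteq\mathcal I^1$ such that $(P_0)$ if $I,I'\in B$, then $I=I'$ or $I\spadesuit I'$ or $I\prec I'$ or $I'\prec I$; $(P_1)$ for every $I\in B$ there are pairwise disjoint $I_1,\dots,I_k\in B$ $(k\ge0)$ with $I_j\prec I$ for all $j$ and $I^{ev}\subseteq I_1\cup\dots\cup I_k$. For $B\in\varphi(\bar V)$ let $L_B\subseteq\bar V$ be the span of $\{\bar e_I: I\in B\}$, and for $s\in S$ let $g_s(B)=|\{I\in B: s\in I\}|$. Put $$\bar\varepsilon(B)=\sum_{s\in S}\tfrac12 g_s(B)\,(g_s(B)+1)\,\bar e_s\in\bar V.$$ For $t\in S$ let $B^t=\{I\in\mathcal I: I\subseteq S\setminus\{t\},\ \bar e_I\in L_B\}$; for $s\in S\setminus\{t\}$ put $$f_s(B)=|\{I\in B^t\cap\mathcal I^1: s\in I\}|-|\{I\in B^t\cap\mathcal I^0: s\in I\}|-r,$$ where $r\in\{0,1\}$ is the parity of $|B^t\cap\mathcal I^0|$, and put $$\varepsilon'_t(B)=\sum_{s\in S\setminus\{t\}}\tfrac12 f_s(B)\,(f_s(B)+1)\,\bar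 e_s\in\bar V.$$ Then: (1) for every $t\in S$, $\varepsilon'_t:\varphi(\bar V)\to\bar V$ is a bijection, and $\varepsilon'_t(B)=\bar\varepsilon(B)$ for every $B\in\varphi(\bar V)$; in particular $\varepsilon'_t$ does not depend on $t$; (2) $\bar\varepsilon(B)\in L_B$ for every $B\in\varphi(\bar V)$, $\bigcup_{B\in\varphi(\bar V)}L_B=\bar V$, and $\bar\varepsilon:\varphi(\bar V)\to\bar V$ is a bijection; (3) $\bar\varepsilon$ is compatible with the dihedral symmetry: every automorphism $\gamma$ of the $N$-cycle graph on $S$ maps $\varphi(\bar V)$ bijectively onto itself, and $\bar\varepsilon(\gamma B)=\gamma\,\bar\varepsilon(B)$ for all $B\in\varphi(\bar V)$, where $\gamma$ acts on $\bar V$ through the linear map induced by $e_s\mapsto e_{\gamma(s)}$. -/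

import Mathlib

namespace SympFam

section Graph

variable {S : Type*} [DecidableEq S]

/-- The full subgraph of `G` on the vertex set `I` is a graph of type `A_m` for some `m ≥ 1`
(a path with `m` vertices). -/
def IsTypeA (G : SimpleGraph S) (I : Finset S) : Prop :=
  ∃ m : ℕ, 1 ≤ m ∧ Nonempty (G.induce (I : Set S) ≃g SimpleGraph.pathGraph m)

/-- `I ∈ ℐ⁰`: a path with an even number of vertices. -/
def IsTypeAEven (G : SimpleGraph S) (I : Finset S) : Prop :=
  IsTypeA G I ∧ Even I.card

/-- `I ∈ ℐ¹`: a path with an odd number of vertices. -/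
def IsTypeAOdd (G : SimpleGraph S) (I : Finset S) : Prop :=
  IsTypeA G I ∧ Odd I.card

/-- The full subgraph of `G` on the vertex set `I` is disconnected. -/
def IsDisconnected (G : SimpleGraph S) (I : Finset S) : Prop :=
  ¬ (G.induce (I : Set S)).Preconnected

/-- The relation `I ≺ I'`. -/
def Prec (G : SimpleGraph S) (I I' : Finset S) : Prop :=
  I ⊂ I' ∧ IsDisconnected G (I' \ I)

/-- The relation `I ♠ I'`. -/
def Spade (G : SimpleGraph S) (I I' : Finset S) : Prop :=
  Disjoint I I' ∧ IsDisconnected G (I ∪ I')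

open Classical in
/-- The set `I^{ev}` of all `s ∈ I` such that `I - {s}` is a disjoint union `I' ⊔ I''` with
`I', I'' ∈ ℐ¹` and `I' ♠ I''`. -/
noncomputable def evPart (G : SimpleGraph S) (I : Finset S) : Finset S :=
  I.filter fun s => ∃ I' I'' : Finset S, IsTypeAOdd G I' ∧ IsTypeAOdd G I'' ∧
    Spade G I' I'' ∧ I.erase s = I' ∪ I''

/-- Property `(P₀)`. -/
def PropP0 (G : SimpleGraph S) (B : Finset (Finset S)) : Prop :=
  ∀ I ∈ B, ∀ I' ∈ B, I = I' ∨ Spade G I I' ∨ Prec G I I' ∨ Prec G I' I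

/-- Property `(P₁)`: for every `I ∈ B`, the set `I^{ev}` is covered by a disjoint family
`I₁, …, I_k` (`k ≥ 0`) of members of `B` with `I_j ≺ I` for all `j`. -/
def PropP1 (G : SimpleGraph S) (B : Finset (Finset S)) : Prop :=
  ∀ I ∈ B, ∃ C : Finset (Finset S), C ⊆ B ∧ (C : Set (Finset S)).PairwiseDisjoint id ∧
    (∀ J ∈ C, Prec G J I) ∧ evPart G I ⊆ C.biUnion id

/-- The set `φ` of all finite sets `B` of elements of `ℐ¹` satisfying `(P₀)` and `(P₁)`. -/
def phi (G : SimpleGraph S) : Set (Finset (Finset S)) :=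
  {B | (∀ I ∈ B, IsTypeAOdd G I) ∧ PropP0 G B ∧ PropP1 G B}

/-- `g_s(B)`: the number of `I ∈ B` containing `s`. -/
def gNum (s : S) (B : Finset (Finset S)) : ℕ :=
  (B.filter fun I => s ∈ I).card

end Graph

section Space

variable {S V : Type*} [DecidableEq S] [AddCommGroup V] [Module (ZMod 2) V]

/-- The graph with vertex set `S` whose edges are the unordered pairs `s ≠ s'` such that
`⟨e_s, e_{s'}⟩ = 1` (the form is symmetric in all cases considered). -/
def edgeGraph (ω : LinearMap.BilinForm (ZMod 2) V) (e : S → V) : SimpleGraph S :=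
  SimpleGraph.fromRel fun s s' => ω (e s) (e s') = 1

/-- `e_I = ∑_{s ∈ I} e_s`. -/
def eSum (e : S → V) (I : Finset S) : V :=
  ∑ s ∈ I, e s

/-- `L_B`: the subspace generated by the `e_I`, `I ∈ B`. -/
def LSub (e : S → V) (B : Finset (Finset S)) : Submodule (ZMod 2) V :=
  Submodule.span (ZMod 2) (eSum e '' (B : Set (Finset S)))

/-- `ε(B) = ∑_{s ∈ S} (1/2) g_s(B) (g_s(B) + 1) e_s`. -/
def eps [Fintype S] (e : S → V) (B : Finset (Finset S)) : V :=
  ∑ s : S, ((gNum s B * (gNum s B + 1) / 2 : ℕ) : ZMod 2) • e s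

open Classical in
/-- `B^t = {I ∈ ℐ ; I ⊆ S - {t}, e_I ∈ L_B}`. -/
noncomputable def BT [Fintype S] (G : SimpleGraph S) (e : S → V) (t : S)
    (B : Finset (Finset S)) : Finset (Finset S) :=
  Finset.univ.filter fun I => IsTypeA G I ∧ t ∉ I ∧ eSum e I ∈ LSub e B

open Classical in
/-- `f_s(B) = |{I ∈ B^t ∩ ℐ¹ ; s ∈ I}| - |{I ∈ B^t ∩ ℐ⁰ ; s ∈ I}| - r`, where `r ∈ {0, 1}` is the
parity of `|B^t ∩ ℐ⁰|`. -/
noncomputable def fNum [Fintype S] (G : SimpleGraph S) (e : S → V) (t s : S)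
    (B : Finset (Finset S)) : ℤ :=
  (((BT G e t B).filter fun I => IsTypeAOdd G I ∧ s ∈ I).card : ℤ)
    - (((BT G e t B).filter fun I => IsTypeAEven G I ∧ s ∈ I).card : ℤ)
    - ((((BT G e t B).filter fun I => IsTypeAEven G I).card % 2 : ℕ) : ℤ)

/-- `ε'(B) = ∑_{s ∈ S - {t}} (1/2) f_s(B) (f_s(B) + 1) e_s`. -/
noncomputable def epsPrime [Fintype S] (G : SimpleGraph S) (e : S → V) (t : S)
    (B : Finset (Finset S)) : V :=
  ∑ s ∈ Finset.univ.erase t, ((fNum G e t s B * (fNum G e t s B + 1) / 2 : ℤ) : ZMod 2) • e s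

end Space

section Circular

variable {S V : Type*} [Fintype S] [DecidableEq S] [AddCommGroup V] [Module (ZMod 2) V]

/-- `V` is an `𝔽₂`-vector space with an alternating bilinear form `ω` and a basis `(e_s)_{s ∈ S}`
such that the associated graph is of affine type `A_{N-1}` (a cycle with `N` vertices),
where `N ∈ {3, 5, 7, …}`. -/
structure IsAffineTypeA (N : ℕ) (ω : LinearMap.BilinForm (ZMod 2) V)
    (e : Module.Basis S (ZMod 2) V) : Prop where
  three_le : 3 ≤ N
  odd : Odd N
  alt : ω.IsAlt
  cycle : Nonempty (edgeGraph ω e ≃g SimpleGraph.cycleGraph N)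

/-- The line `F e_S` in `V`. -/
noncomputable def lineS (e : Module.Basis S (ZMod 2) V) : Submodule (ZMod 2) V :=
  Submodule.span (ZMod 2) {eSum e Finset.univ}

/-- `V̄ = V / F e_S`. -/
abbrev VBar (e : Module.Basis S (ZMod 2) V) : Type _ := V ⧸ lineS e

/-- The vectors `ē_s ∈ V̄`, the images of the `e_s`. -/
noncomputable def eBar (e : Module.Basis S (ZMod 2) V) (s : S) : VBar e := (lineS e).mkQ (e s)

theorem IsAffineTypeA.apply_eSum {N : ℕ} {ω : LinearMap.BilinForm (ZMod 2) V}
    {e : Module.Basis S (ZMod 2) V} (h : IsAffineTypeA N ω e) (t : S) :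
    ω (e t) (eSum e Finset.univ) = 0 := by
  classical
  obtain ⟨φ⟩ := h.cycle
  have h01 : ∀ x : ZMod 2, x = 0 ∨ x = 1 := by decide
  have hval : ∀ s, ω (e t) (e s) = if (edgeGraph ω e).Adj t s then 1 else 0 := by
    intro s
    have hsymm : ω (e s) (e t) = ω (e t) (e s) := by
      rw [← h.alt.neg_eq, ZMod.neg_eq_self_mod_two]
    by_cases hts : t = s
    · subst hts
      simp [h.alt.self_eq_zero]
    · rcases h01 (ω (e t) (e s)) with h0 | h1
      · simp [edgeGraph, hts, hsymm, h0]
      · simp [edgeGraph, hts, h1]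
  obtain ⟨n, rfl⟩ : ∃ n, N = n + 3 := ⟨N - 3, by have := h.three_le; omega⟩
  have hdeg : (edgeGraph ω e).degree t = 2 := by
    rw [← φ.degree_eq t]
    convert SimpleGraph.cycleGraph_degree_three_le
  rw [eSum, map_sum, Finset.sum_congr rfl fun s _ => hval s, Finset.sum_boole,
    ← SimpleGraph.neighborFinset_eq_filter, SimpleGraph.card_neighborFinset_eq_degree, hdeg]
  rfl

theorem IsAffineTypeA.lineS_le_ker_flip {N : ℕ} {ω : LinearMap.BilinForm (ZMod 2) V}
    {e : Module.Basis S (ZMod 2) V} (h : IsAffineTypeA N ω e) :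
    lineS e ≤ LinearMap.ker (LinearMap.flip ω) := by
  rw [lineS, Submodule.span_singleton_le_iff_mem, LinearMap.mem_ker]
  exact e.ext fun t => by simpa using h.apply_eSum t

theorem IsAffineTypeA.lineS_le_ker {N : ℕ} {ω : LinearMap.BilinForm (ZMod 2) V}
    {e : Module.Basis S (ZMod 2) V} (h : IsAffineTypeA N ω e) :
    lineS e ≤ LinearMap.ker ω := by
  rw [lineS, Submodule.span_singleton_le_iff_mem, LinearMap.mem_ker]
  refine e.ext fun t => ?_
  rw [← h.alt.neg_eq, h.apply_eSum t]
  simp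

/-- The form on `V̄` induced by `ω`. -/
noncomputable def IsAffineTypeA.barForm {N : ℕ} {ω : LinearMap.BilinForm (ZMod 2) V}
    {e : Module.Basis S (ZMod 2) V} (h : IsAffineTypeA N ω e) :
    LinearMap.BilinForm (ZMod 2) (VBar e) :=
  LinearMap.liftQ₂ (lineS e) (lineS e) ω h.lineS_le_ker h.lineS_le_ker_flip

/-- The linear map `V̄ → V̄` induced by the permutation `e_s ↦ e_{σ(s)}` of the basis of `V`. -/
noncomputable def permVBar (e : Module.Basis S (ZMod 2) V) (σ : Equiv.Perm S) :
    VBar e →ₗ[ZMod 2] VBar e :=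
  (lineS e).mapQ (lineS e) (e.equiv e σ : V →ₗ[ZMod 2] V) (by
    rw [lineS, Submodule.span_singleton_le_iff_mem, Submodule.mem_comap]
    have hfix : (e.equiv e σ : V →ₗ[ZMod 2] V) (eSum e Finset.univ) = eSum e Finset.univ := by
      simp only [eSum, map_sum, LinearEquiv.coe_coe, Module.Basis.equiv_apply]
      exact Equiv.sum_comp σ (fun s => e s)
    rw [hfix]
    exact Submodule.mem_span_singleton_self _)

/-- The action of a permutation of `S` on finite sets `B` of subsets of `S`. -/
def permR (σ : Equiv.Perm S) (B : Finset (Finset S)) : Finset (Finset S) :=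
  B.image fun I => I.image σ

end Circular

end SympFam

open SympFam

/-!
Let `ρ` be the rotation of the cycle by one step. The proof translates a family `B ∈ φ` into its
depth function `g s = gNum s B`, and the depth function into a function `u : S → ℤ`.

*From families to depths.* Two distinct arcs allowed by `(P₀)` have no boundary edge in common
(`IsRotation.eq_of_compatible`), so `g` changes by at most `1` along each edge. If it does not
change along an edge, then `(P₁)` forces both ends to have depth `0` (`IsRotation.gNum_eq_zero`).
Hence `g` is a depth function in the sense of `IsDepth`. Each member of `B` runs from a point where
`g` increases to the last vertex before `g` drops below its starting value, so `g` determines `B`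
(`IsRotation.eq_of_gNum_eq`). Conversely, the components of the sets `{x | d ≤ g x}`, `d ≥ 1`, form
a family in `φ` with depth function `g` as soon as `g` has a zero
(`IsRotation.exists_phi_of_isDepth`); it always has one, since otherwise its parity would alternate
around a cycle of odd length.

*From depths to words.* Send depths `0, 1, 2, 3, 4, …` to `0, 1, -1, 2, -2, …`. Then `g` is a depth
function exactly when the signed depths `u` satisfy `u s + u (ρ s) ∈ {0, 1}` for all `s`, and
`g (g + 1) / 2` has the parity of `u`. Given a word `w` modulo `2`, taken up to complement, the
sums `w s + w (ρ s)` prescribe the values `u s + u (ρ s) ∈ {0, 1}`. As the cycle is odd, this linear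
system has exactly one rational solution, half an alternating sum, and it is integral because the
prescribed values have an even sum. This gives the bijection `IsRotation.bijOn_eps`.

*The subspace `L_B`.* The members of `B` containing a given `s` form a chain, so `g (g + 1) / 2` is
the sum over them of the number of members of `B` containing each, and `ε̄(B)` is a combination of
the vectors of the members of `B` (`eps_mem_LSub`).

*Independence of `t`.* The linear forms `x ↦ x_s + x_{ρ s}` detect boundary edges, and distinct
members of `B` have disjoint boundaries; so the only arcs with vector in `L_B` are the members of
`B` and their complements (`IsRotation.mem_or_compl_mem_of_eSum_mem`). This yields
`f_s = g_s - g_t - r` (`IsRotation.fNum_eq`), where `g_t + r` is even. An even shift of `n` changes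
the parity of `n (n + 1) / 2` by a constant, which vanishes in the quotient by `e_S`
(`IsRotation.epsPrime_eq_eps`).
-/

open SympFam

namespace SympFam

/-! ### Arcs of a cycle -/

section Rotation

variable {S : Type*}

/-- The permutation `ρ` rotates the graph `G` by one step, and `G` is the cycle of length `N`
traced by `ρ`. -/
structure IsRotation (G : SimpleGraph S) (ρ : Equiv.Perm S) (N : ℕ) : Prop where
  three_le : 3 ≤ N
  adj_iff : ∀ s t, G.Adj s t ↔ t = ρ s ∨ s = ρ t
  pow_eq_iff : ∀ s i j, (ρ ^ i) s = (ρ ^ j) s ↔ i ≡ j [MOD N]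
  exists_pow : ∀ s t, ∃ i < N, (ρ ^ i) s = t

theorem exists_isRotation {G : SimpleGraph S} {N : ℕ} (hN : 3 ≤ N)
    (φ : G ≃g SimpleGraph.cycleGraph N) : ∃ ρ, IsRotation G ρ N := by
  obtain ⟨n, rfl⟩ : ∃ n, N = n + 2 := ⟨N - 2, by omega⟩
  let ρ : Equiv.Perm S := φ.toEquiv.trans ((Equiv.addRight 1).trans φ.toEquiv.symm)
  have hρ : ∀ s, φ (ρ s) = φ s + 1 := fun s => φ.apply_symm_apply _
  have hpow : ∀ (i : ℕ) s, (φ ((ρ ^ i) s)).val = ((φ s).val + i) % (n + 2) := by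
    intro i s
    induction i with
    | zero => simp [Nat.mod_eq_of_lt (φ s).isLt]
    | succ i ih =>
      rw [pow_succ', Equiv.Perm.mul_apply, hρ, Fin.val_add, ih, Fin.val_one, Nat.mod_add_mod,
        add_assoc]
  refine ⟨ρ, hN, fun s t => ?_, fun s i j => ?_, fun s t => ?_⟩
  · rw [← φ.map_adj_iff, SimpleGraph.cycleGraph_adj, or_comm]
    refine or_congr ?_ ?_
    · rw [← φ.injective.eq_iff, hρ, sub_eq_iff_eq_add']
    · rw [← φ.injective.eq_iff, hρ, sub_eq_iff_eq_add']
  · rw [← φ.injective.eq_iff, Fin.ext_iff, hpow, hpow]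
    exact ⟨fun e => Nat.ModEq.add_left_cancel' _ e, fun e => Nat.ModEq.add_left _ e⟩
  · refine ⟨(φ t - φ s).val, (φ t - φ s).isLt, φ.injective (Fin.ext ?_)⟩
    rw [hpow, ← Fin.val_add, add_sub_cancel]

theorem IsTypeA.preconnected {G : SimpleGraph S} {I : Finset S} (hI : IsTypeA G I) :
    (G.induce (I : Set S)).Preconnected := by
  obtain ⟨m, -, ⟨f⟩⟩ := hI
  exact f.preconnected_iff.2 (SimpleGraph.pathGraph_preconnected m)

theorem IsTypeA.nonempty {G : SimpleGraph S} {I : Finset S} (hI : IsTypeA G I) : I.Nonempty := by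
  obtain ⟨m, hm, ⟨f⟩⟩ := hI
  exact ⟨_, (f.symm ⟨0, hm⟩).2⟩

namespace IsRotation

variable {G : SimpleGraph S} {ρ : Equiv.Perm S} {N : ℕ}

theorem symm (h : IsRotation G ρ N) : IsRotation G ρ⁻¹ N := by
  have key : ∀ (i : ℕ) s t, (ρ⁻¹ ^ i) s = t ↔ (ρ ^ i) t = s := by
    intro i s t
    rw [inv_pow, Equiv.Perm.inv_eq_iff_eq, eq_comm]
  refine ⟨h.three_le, fun s t => ?_, fun s i j => ?_, fun s t => ?_⟩
  · rw [h.adj_iff, Equiv.Perm.eq_inv_iff_eq, Equiv.Perm.eq_inv_iff_eq, or_comm,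
      eq_comm (a := s), eq_comm (a := t)]
  · rw [← h.pow_eq_iff ((ρ⁻¹ ^ i * ρ⁻¹ ^ j) s)]
    have h1 : (ρ ^ i) ((ρ⁻¹ ^ i * ρ⁻¹ ^ j) s) = (ρ⁻¹ ^ j) s := by simp
    have h2 : (ρ ^ j) ((ρ⁻¹ ^ i * ρ⁻¹ ^ j) s) = (ρ⁻¹ ^ i) s := by
      rw [← pow_add, add_comm, pow_add]; simp
    rw [h1, h2]
    exact eq_comm
  · obtain ⟨i, hi, e⟩ := h.exists_pow t s
    exact ⟨i, hi, (key i s t).2 e⟩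

theorem pow_card (h : IsRotation G ρ N) (s : S) : (ρ ^ N) s = s := by
  have := (h.pow_eq_iff s N 0).2 (by simp [Nat.ModEq])
  simpa using this

theorem pow_inj (h : IsRotation G ρ N) {s : S} {i j : ℕ} (hi : i < N) (hj : j < N) :
    (ρ ^ i) s = (ρ ^ j) s ↔ i = j := by
  rw [h.pow_eq_iff]
  exact ⟨fun e => Nat.ModEq.eq_of_lt_of_lt e hi hj, fun e => e ▸ rfl⟩

theorem pow_pred (h : IsRotation G ρ N) (s : S) : (ρ ^ (N - 1)) s = ρ⁻¹ s := by
  have h3 := h.three_le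
  rw [Equiv.Perm.eq_inv_iff_eq, ← Equiv.Perm.mul_apply, ← pow_succ', Nat.sub_add_cancel (by omega),
    h.pow_card]

theorem adj_pow_iff (h : IsRotation G ρ N) (a : S) {i j : ℕ} (hi : i + 1 < N) (hj : j + 1 < N) :
    G.Adj ((ρ ^ i) a) ((ρ ^ j) a) ↔ j = i + 1 ∨ i = j + 1 := by
  rw [h.adj_iff, ← Equiv.Perm.mul_apply, ← Equiv.Perm.mul_apply,
      ← pow_succ', ← pow_succ', h.pow_inj (by omega) (by omega), h.pow_inj (by omega) (by omega)]

theorem adj_self (h : IsRotation G ρ N) (s : S) : G.Adj s (ρ s) :=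
  (h.adj_iff _ _).2 (Or.inl rfl)

theorem exists_mem_not_mem (h : IsRotation G ρ N) {X : Set S} {s t : S} (hs : s ∈ X) (ht : t ∉ X) :
    ∃ x ∈ X, ρ x ∉ X := by
  by_contra! hc
  obtain ⟨i, -, rfl⟩ := h.exists_pow s t
  refine ht ?_
  clear ht
  induction i with
  | zero => simpa using hs
  | succ i ih => rw [pow_succ']; exact hc _ ih

/-- A cycle is not a path: the end of a path has at most one neighbour. -/
theorem exists_not_mem (h : IsRotation G ρ N) {I : Finset S} (hI : IsTypeA G I) : ∃ x, x ∉ I := by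
  obtain ⟨m, hm, ⟨f⟩⟩ := hI
  by_contra! hall
  have h3 := h.three_le
  set x : (I : Set S) := f.symm ⟨0, hm⟩ with hx
  have hfx : f x = ⟨0, hm⟩ := by simp [hx]
  have hnb : ∀ y (hy : G.Adj x y), ((f ⟨y, hall y⟩ : Fin m) : ℕ) = 1 := by
    intro y hy
    have : (G.induce (I : Set S)).Adj x ⟨y, hall y⟩ := hy
    rw [← f.map_adj_iff, hfx, SimpleGraph.pathGraph_adj] at this
    simp only at this
    omega
  have e := (hnb _ (h.adj_self _)).trans (hnb _ (h.symm.adj_self _)).symm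
  have e2 := congrArg Subtype.val (f.injective (Fin.ext e))
  simp only at e2
  rw [← h.pow_pred] at e2
  have := (h.pow_inj (i := 1) (j := N - 1) (by omega) (by omega)).1 (by simpa using e2)
  omega

theorem exists_start (h : IsRotation G ρ N) {I : Finset S} (hI : I.Nonempty)
    {t : S} (ht : t ∉ I) : ∃ a ∈ I, ρ⁻¹ a ∉ I := by
  obtain ⟨s, hs⟩ := hI
  exact h.symm.exists_mem_not_mem (X := (I : Set S)) hs ht

end IsRotation

/-- A set closed under adjacency inside a connected vertex set contains it as soon as it meets
it. -/
theorem mem_of_preconnected_induce {G : SimpleGraph S} {I X : Set S}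
    (hI : (G.induce I).Preconnected)
    (hX : ∀ x ∈ I, ∀ y ∈ I, G.Adj x y → x ∈ X → y ∈ X) {x : S} (hx : x ∈ I) (hxX : x ∈ X)
    {y : S} (hy : y ∈ I) : y ∈ X := by
  obtain ⟨w⟩ := hI ⟨x, hx⟩ ⟨y, hy⟩
  have : ∀ u v : I, (G.induce I).Walk u v → (u : S) ∈ X → (v : S) ∈ X := by
    intro u v w
    induction w with
    | nil => exact id
    | cons hadj _ ih =>
      exact fun hu => ih (hX _ (Subtype.property _) _ (Subtype.property _) hadj hu)
  exact this _ _ w hxX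

theorem isDisconnected_union [DecidableEq S] {G : SimpleGraph S} {X Y : Finset S}
    (hX : X.Nonempty) (hY : Y.Nonempty) (hd : Disjoint X Y)
    (hadj : ∀ x ∈ X, ∀ y ∈ Y, ¬ G.Adj x y) : IsDisconnected G (X ∪ Y) := by
  intro hc
  obtain ⟨x, hx⟩ := hX
  obtain ⟨y, hy⟩ := hY
  have := mem_of_preconnected_induce (X := (X : Set S)) hc (x := x) (y := y) ?_ (by simp [hx])
    (by simpa using hx) (by simp [hy])
  · exact Finset.disjoint_left.1 hd (by simpa using this) hy
  · intro u hu v hv huv hu'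
    simp only [Finset.coe_union, Set.mem_union, Finset.mem_coe] at hv hu' ⊢
    exact hv.resolve_right fun hv' => hadj u hu' v hv' huv

section Arc

variable [DecidableEq S]

/-- The arc of `k` successive vertices of a cycle with rotation `ρ`, starting at `a`. -/
def arc (ρ : Equiv.Perm S) (a : S) (k : ℕ) : Finset S :=
  (Finset.range k).image fun i => (ρ ^ i) a

theorem mem_arc {ρ : Equiv.Perm S} {a x : S} {k : ℕ} :
    x ∈ arc ρ a k ↔ ∃ i < k, (ρ ^ i) a = x := by
  simp [arc]

theorem arc_add (ρ : Equiv.Perm S) (a : S) (k l : ℕ) :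
    arc ρ a (k + l) = arc ρ a k ∪ arc ρ ((ρ ^ k) a) l := by
  ext x
  simp only [Finset.mem_union, mem_arc]
  constructor
  · rintro ⟨i, hi, rfl⟩
    by_cases hik : i < k
    · exact Or.inl ⟨i, hik, rfl⟩
    · refine Or.inr ⟨i - k, by omega, ?_⟩
      rw [← Equiv.Perm.mul_apply, ← pow_add, Nat.sub_add_cancel (by omega)]
  · rintro (⟨i, hi, rfl⟩ | ⟨i, hi, rfl⟩)
    · exact ⟨i, by omega, rfl⟩
    · exact ⟨i + k, by omega, by rw [pow_add, Equiv.Perm.mul_apply]⟩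

namespace IsRotation

variable {G : SimpleGraph S} {ρ : Equiv.Perm S} {N : ℕ}

theorem pow_mem_arc (h : IsRotation G ρ N) {a : S} {i k : ℕ} (hi : i < N) (hk : k ≤ N) :
    (ρ ^ i) a ∈ arc ρ a k ↔ i < k := by
  rw [mem_arc]
  refine ⟨?_, fun hik => ⟨i, hik, rfl⟩⟩
  rintro ⟨j, hj, e⟩
  rw [h.pow_inj (by omega) hi] at e
  omega

theorem card_arc (h : IsRotation G ρ N) (a : S) {k : ℕ} (hk : k ≤ N) : (arc ρ a k).card = k := by
  rw [arc, Finset.card_image_of_injOn, Finset.card_range]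
  intro i hi j hj e
  simp only [Finset.coe_range, Set.mem_Iio] at hi hj
  exact (h.pow_inj (by omega) (by omega)).1 e

theorem card_eq [Fintype S] (h : IsRotation G ρ N) (a : S) : Fintype.card S = N := by
  rw [← h.card_arc a le_rfl, ← Finset.card_univ]
  congr 1
  ext x
  simpa [mem_arc] using h.exists_pow a x

theorem preconnected_arc (h : IsRotation G ρ N) (a : S) (k : ℕ) :
    (G.induce (arc ρ a k : Set S)).Preconnected := by
  have key : ∀ i (hi : i < k), (G.induce (arc ρ a k : Set S)).Reachable
      ⟨a, mem_arc.2 ⟨0, by omega, rfl⟩⟩ ⟨(ρ ^ i) a, mem_arc.2 ⟨i, hi, rfl⟩⟩ := by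
    intro i
    induction i with
    | zero => intro hi; exact SimpleGraph.Reachable.refl _
    | succ i ih =>
      intro hi
      refine (ih (by omega)).trans (SimpleGraph.Adj.reachable ?_)
      have hadj := h.adj_self ((ρ ^ i) a)
      rw [← Equiv.Perm.mul_apply, ← pow_succ'] at hadj
      exact hadj
  rintro ⟨x, hx⟩ ⟨y, hy⟩
  obtain ⟨i, hi, rfl⟩ := mem_arc.1 hx
  obtain ⟨j, hj, rfl⟩ := mem_arc.1 hy
  exact (key i hi).symm.trans (key j hj)

/-- A connected set of vertices with a starting point is the arc from there up to the first vertex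
outside it. -/
theorem eq_arc_of_preconnected (h : IsRotation G ρ N) {I : Finset S}
    (hI : (G.induce (I : Set S)).Preconnected) {a : S} (ha : a ∈ I) (ha' : ρ⁻¹ a ∉ I) :
    ∃ k, 1 ≤ k ∧ k < N ∧ (ρ ^ k) a ∉ I ∧ I = arc ρ a k := by
  classical
  have hex : ∃ k, (ρ ^ k) a ∉ I := ⟨N - 1, by rwa [h.pow_pred]⟩
  have h3 := h.three_le
  have hkN : Nat.find hex ≤ N - 1 := Nat.find_min' hex (by rwa [h.pow_pred])
  have hlt : ∀ i < Nat.find hex, (ρ ^ i) a ∈ I := fun i hi => by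
    simpa using Nat.find_min hex hi
  have hk1 : 1 ≤ Nat.find hex := by
    rw [Nat.one_le_iff_ne_zero]
    intro h0
    have := Nat.find_spec hex
    rw [h0] at this
    exact this (by simpa using ha)
  refine ⟨Nat.find hex, hk1, by omega, Nat.find_spec hex, ?_⟩
  refine Finset.Subset.antisymm (fun y hy => ?_) (fun y hy => ?_)
  · refine mem_of_preconnected_induce (X := (arc ρ a (Nat.find hex) : Set S)) hI ?_
      (x := a) ha (mem_arc.2 ⟨0, by omega, rfl⟩) hy
    intro x _ y hy hadj hx
    obtain ⟨i, hi, rfl⟩ := mem_arc.1 hx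
    rcases (h.adj_iff _ _).1 hadj with e | e
    · rw [← Equiv.Perm.mul_apply, ← pow_succ'] at e
      subst e
      refine mem_arc.2 ⟨i + 1, ?_, rfl⟩
      rcases Nat.lt_or_ge (i + 1) (Nat.find hex) with hlt' | hge
      · exact hlt'
      · have e : i + 1 = Nat.find hex := by omega
        exact absurd (e ▸ hy) (Nat.find_spec hex)
    · cases i with
      | zero =>
        have : y = ρ⁻¹ a := by rw [Equiv.Perm.eq_inv_iff_eq, ← e]; rfl
        exact absurd (this ▸ hy) ha'
      | succ i =>
        rw [pow_succ', Equiv.Perm.mul_apply, ρ.injective.eq_iff] at e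
        exact mem_arc.2 ⟨i, by omega, e⟩
  · obtain ⟨i, hi, rfl⟩ := mem_arc.1 hy
    exact hlt i hi

theorem isTypeA_arc (h : IsRotation G ρ N) (a : S) {k : ℕ} (hk : 1 ≤ k) (hkN : k < N) :
    IsTypeA G (arc ρ a k) := by
  refine ⟨k, hk, ⟨RelIso.symm ⟨Equiv.ofBijective
    (fun i : Fin k => (⟨(ρ ^ (i : ℕ)) a, mem_arc.2 ⟨i, i.isLt, rfl⟩⟩ : (arc ρ a k : Set S)))
    ⟨?_, ?_⟩, ?_⟩⟩⟩
  · intro i j e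
    have := congrArg Subtype.val e
    exact Fin.ext ((h.pow_inj (by omega) (by omega)).1 this)
  · rintro ⟨x, hx⟩
    obtain ⟨i, hi, rfl⟩ := mem_arc.1 hx
    exact ⟨⟨i, hi⟩, rfl⟩
  · intro i j
    change G.Adj ((ρ ^ (i : ℕ)) a) ((ρ ^ (j : ℕ)) a) ↔ _
    rw [h.adj_iff, SimpleGraph.pathGraph_adj, ← Equiv.Perm.mul_apply, ← Equiv.Perm.mul_apply,
      ← pow_succ', ← pow_succ', h.pow_inj (by omega) (by omega), h.pow_inj (by omega) (by omega)]
    omega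

end IsRotation

namespace IsRotation

variable {G : SimpleGraph S} {ρ : Equiv.Perm S} {N : ℕ}

theorem isTypeA_iff (h : IsRotation G ρ N) {I : Finset S} :
    IsTypeA G I ↔ ∃ a k, 1 ≤ k ∧ k < N ∧ I = arc ρ a k := by
  constructor
  · intro hI
    obtain ⟨t, ht⟩ := h.exists_not_mem hI
    obtain ⟨a, ha, ha'⟩ := h.exists_start hI.nonempty ht
    obtain ⟨k, h1, h2, -, h3⟩ := h.eq_arc_of_preconnected hI.preconnected ha ha'
    exact ⟨a, k, h1, h2, h3⟩
  · rintro ⟨a, k, h1, h2, rfl⟩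
    exact h.isTypeA_arc a h1 h2

theorem inv_not_mem_arc (h : IsRotation G ρ N) (a : S) {k : ℕ} (hk : k < N) :
    ρ⁻¹ a ∉ arc ρ a k := by
  have h3 := h.three_le
  rw [← h.pow_pred, h.pow_mem_arc (by omega) (by omega)]
  omega

end IsRotation

end Arc

end Rotation

/-! ### Compatible arcs -/

section Compatible

variable {S : Type*} [DecidableEq S] {G : SimpleGraph S} {ρ : Equiv.Perm S} {N : ℕ}

theorem Spade.symm {I J : Finset S} (h : Spade G I J) : Spade G J I :=
  ⟨h.1.symm, by rw [Finset.union_comm]; exact h.2⟩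

namespace IsRotation

theorem disjoint_arc (h : IsRotation G ρ N) (a : S) {i j l : ℕ} (hij : i ≤ j) (hl : j + l ≤ N) :
    Disjoint (arc ρ a i) (arc ρ ((ρ ^ j) a) l) := by
  rw [Finset.disjoint_left]
  intro x hx hx'
  obtain ⟨u, hu, rfl⟩ := mem_arc.1 hx
  obtain ⟨v, hv, e⟩ := mem_arc.1 hx'
  rw [← Equiv.Perm.mul_apply, ← pow_add, h.pow_inj (by omega) (by omega)] at e
  omega

theorem not_adj_arc (h : IsRotation G ρ N) (a : S) {i j l : ℕ} (hij : i < j) (hl : j + l < N)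
    {x y : S} (hx : x ∈ arc ρ a i) (hy : y ∈ arc ρ ((ρ ^ j) a) l) : ¬ G.Adj x y := by
  obtain ⟨u, hu, rfl⟩ := mem_arc.1 hx
  obtain ⟨v, hv, rfl⟩ := mem_arc.1 hy
  rw [← Equiv.Perm.mul_apply, ← pow_add, h.adj_pow_iff a (by omega) (by omega)]
  omega

theorem nonempty_arc (a : S) {k : ℕ} (hk : 1 ≤ k) : (arc ρ a k).Nonempty :=
  ⟨a, mem_arc.2 ⟨0, hk, rfl⟩⟩

theorem isDisconnected_arc_union (h : IsRotation G ρ N) (a : S) {i j l : ℕ} (hi : 1 ≤ i)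
    (hij : i < j) (hl' : 1 ≤ l) (hl : j + l < N) :
    IsDisconnected G (arc ρ a i ∪ arc ρ ((ρ ^ j) a) l) :=
  isDisconnected_union (nonempty_arc a hi) (nonempty_arc _ hl') (h.disjoint_arc a hij.le hl.le)
    fun _ hx _ hy => h.not_adj_arc a hij hl hx hy

theorem exists_eq_arc (h : IsRotation G ρ N) {I : Finset S} (hI : IsTypeA G I) {a : S}
    (ha : a ∈ I) (ha' : ρ⁻¹ a ∉ I) : ∃ k, 1 ≤ k ∧ k < N ∧ (ρ ^ k) a ∉ I ∧ I = arc ρ a k :=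
  h.eq_arc_of_preconnected hI.preconnected ha ha'

end IsRotation

theorem mem_evPart {I : Finset S} {s : S} : s ∈ evPart G I ↔ s ∈ I ∧
    ∃ I' I'' : Finset S, IsTypeAOdd G I' ∧ IsTypeAOdd G I'' ∧
      Spade G I' I'' ∧ I.erase s = I' ∪ I'' := by
  classical
  simp only [evPart, Finset.mem_filter]

/-- The alternatives allowed by property `(P₀)` for two members of a family. -/
def Compatible (G : SimpleGraph S) (I J : Finset S) : Prop :=
  I = J ∨ Spade G I J ∨ Prec G I J ∨ Prec G J I

theorem Compatible.symm {I J : Finset S} (h : Compatible G I J) : Compatible G J I := by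
  rcases h with h | h | h | h
  · exact Or.inl h.symm
  · exact Or.inr (Or.inl h.symm)
  · exact Or.inr (Or.inr (Or.inr h))
  · exact Or.inr (Or.inr (Or.inl h))

namespace IsRotation

theorem eq_of_compatible_start (h : IsRotation G ρ N) {I J : Finset S} (hI : IsTypeA G I)
    (hJ : IsTypeA G J) (hc : Compatible G I J) {a : S} (haI : a ∈ I) (haI' : ρ⁻¹ a ∉ I)
    (haJ : a ∈ J) (haJ' : ρ⁻¹ a ∉ J) : I = J := by
  obtain ⟨k, hk, hkN, -, rfl⟩ := h.exists_eq_arc hI haI haI'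
  obtain ⟨l, hl, hlN, -, rfl⟩ := h.exists_eq_arc hJ haJ haJ'
  wlog hkl : k ≤ l generalizing k l
  · exact (this l hl hlN hJ haJ haJ' k hk hkN hI haI haI' hc.symm (by omega)).symm
  rcases hc with hc | hc | hc | hc
  · exact hc
  · exact absurd haJ (Finset.disjoint_left.1 hc.1 haI)
  · obtain ⟨m, rfl⟩ := Nat.exists_eq_add_of_le hkl
    refine absurd ?_ hc.2
    rw [arc_add, Finset.union_sdiff_cancel_left (h.disjoint_arc a le_rfl (by omega))]
    exact h.preconnected_arc _ _
  · have := Finset.card_lt_card hc.1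
    rw [h.card_arc a hkN.le, h.card_arc a hlN.le] at this
    omega

theorem not_compatible_of_adjacent (h : IsRotation G ρ N) {I J : Finset S} (hI : IsTypeA G I)
    (hJ : IsTypeA G J) {s : S} (h1 : s ∈ I) (h2 : ρ s ∉ I) (h3 : s ∉ J) (h4 : ρ s ∈ J) :
    ¬ Compatible G I J := by
  rintro (hc | hc | hc | hc)
  · exact h3 (hc ▸ h1)
  · obtain ⟨t, ht⟩ := h.exists_not_mem hI
    obtain ⟨a, ha, ha'⟩ := h.exists_start hI.nonempty ht
    obtain ⟨k, hk, hkN, hak, hIk⟩ := h.exists_eq_arc hI ha ha'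
    obtain ⟨l, hl, hlN, -, hJl⟩ := h.exists_eq_arc hJ h4 (by simpa using h3)
    have hs : (ρ ^ k) a = ρ s := by
      rw [hIk] at h1
      obtain ⟨i, hi, rfl⟩ := mem_arc.1 h1
      rw [← Equiv.Perm.mul_apply, ← pow_succ'] at h2 ⊢
      rw [hIk, h.pow_mem_arc (by omega) hkN.le] at h2
      rw [show i + 1 = k by omega]
    refine absurd ?_ hc.2
    rw [hIk, hJl, ← hs, ← arc_add]
    exact h.preconnected_arc _ _
  · exact h3 (hc.1.1 h1)
  · exact h2 (hc.1.1 h4)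

/-- Distinct compatible arcs have no boundary edge in common. -/
theorem eq_of_compatible (h : IsRotation G ρ N) {I J : Finset S} (hI : IsTypeA G I)
    (hJ : IsTypeA G J) (hc : Compatible G I J) {s : S} (hsI : s ∈ I ↔ ρ s ∉ I)
    (hsJ : s ∈ J ↔ ρ s ∉ J) : I = J := by
  by_cases h1 : s ∈ I <;> by_cases h2 : s ∈ J
  · refine h.symm.eq_of_compatible_start (a := s) hI hJ hc h1 ?_ h2 ?_
    · simpa using hsI.1 h1
    · simpa using hsJ.1 h2
  · exact absurd hc (h.not_compatible_of_adjacent hI hJ h1 (hsI.1 h1) h2 (by tauto))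
  · exact absurd hc.symm (h.not_compatible_of_adjacent hJ hI h2 (hsJ.1 h2) h1 (by tauto))
  · refine h.eq_of_compatible_start (a := ρ s) hI hJ hc (by tauto) ?_ (by tauto) ?_
    · simpa using h1
    · simpa using h2

/-- The even positions of an arc are those at an odd distance from its start. -/
theorem pow_mem_evPart_iff (h : IsRotation G ρ N) (a : S) {n i : ℕ} (hn : Odd n) (hnN : n < N)
    (hi : i < n) : (ρ ^ i) a ∈ evPart G (arc ρ a n) ↔ Odd i := by
  have hmem : (ρ ^ i) a ∈ arc ρ a n := (h.pow_mem_arc (by omega) hnN.le).2 hi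
  -- removing one vertex leaves the arcs before and after it
  have hsplit : (arc ρ a n).erase ((ρ ^ i) a) =
      arc ρ a i ∪ arc ρ ((ρ ^ (i + 1)) a) (n - 1 - i) := by
    ext x
    simp only [Finset.mem_erase, Finset.mem_union, mem_arc]
    constructor
    · rintro ⟨hne, j, hj, rfl⟩
      rcases lt_trichotomy j i with hji | rfl | hji
      · exact Or.inl ⟨j, hji, rfl⟩
      · exact absurd rfl hne
      · exact Or.inr ⟨j - (i + 1), by omega, by
          rw [← Equiv.Perm.mul_apply, ← pow_add, Nat.sub_add_cancel (by omega)]⟩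
    · rintro (⟨j, hj, rfl⟩ | ⟨j, hj, rfl⟩)
      · refine ⟨?_, j, by omega, rfl⟩
        rw [Ne, h.pow_inj (by omega) (by omega)]
        omega
      · rw [← Equiv.Perm.mul_apply, ← pow_add]
        refine ⟨?_, j + (i + 1), by omega, rfl⟩
        rw [Ne, h.pow_inj (by omega) (by omega)]
        omega
  rw [mem_evPart]
  constructor
  · rintro ⟨-, I, J, hI, hJ, hs, he⟩
    rw [hsplit] at he
    set X := arc ρ a i
    set Y := arc ρ ((ρ ^ (i + 1)) a) (n - 1 - i)
    have hXY : Disjoint X Y := h.disjoint_arc a (by omega) (by omega)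
    have hadj : ∀ x ∈ X, ∀ y ∈ Y, ¬ G.Adj x y := fun x hx y hy =>
      h.not_adj_arc a (by omega) (by omega) hx hy
    -- a connected subset of `X ∪ Y` lies on one side
    have side : ∀ K : Finset S, IsTypeA G K → K ⊆ X ∪ Y → K ⊆ X ∨ K ⊆ Y := by
      intro K hK hKs
      by_cases hKX : ∃ x ∈ K, x ∈ X
      · obtain ⟨x, hxK, hxX⟩ := hKX
        refine Or.inl fun y hy => ?_
        refine mem_of_preconnected_induce (X := (X : Set S)) hK.preconnected ?_ hxK hxX hy
        intro u _ v hv huv huX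
        exact (Finset.mem_union.1 (hKs hv)).resolve_right fun hvY => hadj u huX v hvY huv
      · push Not at hKX
        exact Or.inr fun y hy => (Finset.mem_union.1 (hKs hy)).resolve_left (hKX y hy)
    have notle : ∀ Z : Finset S, (G.induce (Z : Set S)).Preconnected → I ∪ J ≠ Z :=
      fun Z hZ e => hs.2 (e ▸ hZ)
    have hXc : Odd X.card → Odd i := by rw [h.card_arc a (by omega)]; exact id
    rcases side I hI.1 (he ▸ Finset.subset_union_left) with h1 | h1 <;>
      rcases side J hJ.1 (he ▸ Finset.subset_union_right) with h2 | h2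
    · refine absurd ?_ (notle X (h.preconnected_arc _ _))
      exact (Finset.union_subset h1 h2).antisymm (he ▸ Finset.subset_union_left)
    · have : X = I := Finset.Subset.antisymm (fun x hx => by
        have : x ∈ I ∪ J := he ▸ Finset.mem_union_left _ hx
        exact (Finset.mem_union.1 this).resolve_right fun hxJ =>
          Finset.disjoint_left.1 hXY hx (h2 hxJ)) h1
      exact hXc (this ▸ hI.2)
    · have : X = J := Finset.Subset.antisymm (fun x hx => by
        have : x ∈ I ∪ J := he ▸ Finset.mem_union_left _ hx
        exact (Finset.mem_union.1 this).resolve_left fun hxI =>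
          Finset.disjoint_left.1 hXY hx (h1 hxI)) h2
      exact hXc (this ▸ hJ.2)
    · refine absurd ?_ (notle Y (h.preconnected_arc _ _))
      exact (Finset.union_subset h1 h2).antisymm (he ▸ Finset.subset_union_right)
  · intro hio
    have hi1 : 1 ≤ i := hio.pos
    have hodd : Odd (n - 1 - i) := by
      rw [Nat.odd_iff] at *
      omega
    refine ⟨hmem, _, _, ⟨h.isTypeA_arc a hi1 (by omega), ?_⟩,
      ⟨h.isTypeA_arc _ hodd.pos (by omega), ?_⟩,
      ⟨h.disjoint_arc a (Nat.le_succ i) (by omega), ?_⟩, hsplit⟩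
    · rwa [h.card_arc a (by omega)]
    · rwa [h.card_arc _ (by omega)]
    · exact h.isDisconnected_arc_union a hi1 (Nat.lt_succ_self i) hodd.pos (by omega)

end IsRotation

end Compatible

/-! ### Depth functions -/

section Depth

variable {S : Type*} [DecidableEq S] {G : SimpleGraph S} {ρ : Equiv.Perm S} {N : ℕ}

/-- `g` changes by exactly one along each edge of the cycle, except that it may stay at `0`. -/
def IsDepth (ρ : Equiv.Perm S) (g : S → ℕ) : Prop :=
  ∀ s, (g s = 0 ∧ g (ρ s) = 0) ∨ g (ρ s) = g s + 1 ∨ g s = g (ρ s) + 1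

variable {B : Finset (Finset S)}

theorem gNum_eq_of_not_cut {s t : S} (hne : ∀ I ∈ B, s ∈ I ↔ t ∈ I) :
    gNum s B = gNum t B := by
  unfold gNum
  congr 1
  exact Finset.filter_congr hne

theorem gNum_eq_succ {s t : S} {I : Finset S} (hI : I ∈ B) (hs : s ∉ I) (ht : t ∈ I)
    (hne : ∀ J ∈ B, J ≠ I → (s ∈ J ↔ t ∈ J)) : gNum t B = gNum s B + 1 := by
  have : (B.filter fun J => t ∈ J) = insert I (B.filter fun J => s ∈ J) := by
    ext J
    simp only [Finset.mem_filter, Finset.mem_insert]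
    constructor
    · rintro ⟨hJ, htJ⟩
      by_cases e : J = I
      · exact Or.inl e
      · exact Or.inr ⟨hJ, (hne J hJ e).2 htJ⟩
    · rintro (rfl | ⟨hJ, hsJ⟩)
      · exact ⟨hI, ht⟩
      · exact ⟨hJ, (hne J hJ (fun e => hs (e ▸ hsJ))).1 hsJ⟩
  rw [gNum, this, Finset.card_insert_of_notMem (by simp [hs]), gNum]

namespace IsRotation

theorem unique_cut (h : IsRotation G ρ N) (hB : B ∈ phi G) {I J : Finset S} (hI : I ∈ B)
    (hJ : J ∈ B) {s : S} (hsI : s ∈ I ↔ ρ s ∉ I) (hsJ : s ∈ J ↔ ρ s ∉ J) : I = J :=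
  h.eq_of_compatible (hB.1 I hI).1 (hB.1 J hJ).1 (hB.2.1 I hI J hJ) hsI hsJ

theorem gNum_start (h : IsRotation G ρ N) (hB : B ∈ phi G) {I : Finset S} (hI : I ∈ B) {s : S}
    (hs : s ∉ I) (hs' : ρ s ∈ I) : gNum (ρ s) B = gNum s B + 1 := by
  refine gNum_eq_succ hI hs hs' fun J hJ hne => ?_
  by_contra hcon
  exact hne (h.unique_cut hB hJ hI (s := s) (by tauto) (by tauto))

theorem gNum_end (h : IsRotation G ρ N) (hB : B ∈ phi G) {I : Finset S} (hI : I ∈ B) {s : S}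
    (hs : s ∈ I) (hs' : ρ s ∉ I) : gNum s B = gNum (ρ s) B + 1 := by
  refine gNum_eq_succ hI hs' hs fun J hJ hne => ?_
  by_contra hcon
  exact hne (h.unique_cut hB hJ hI (s := s) (by tauto) (by tauto))

/-- If no member of `B` has a boundary edge between `s` and `ρ s`, then no member contains `s`:
in a minimal one containing `s`, either `s` or `ρ s` is at an even position, and property `(P₁)`
gives a smaller one. -/
theorem gNum_eq_zero (h : IsRotation G ρ N) (hB : B ∈ phi G) {s : S}
    (hs : ∀ I ∈ B, s ∈ I ↔ ρ s ∈ I) : gNum s B = 0 := by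
  rw [gNum, Finset.card_eq_zero, Finset.filter_eq_empty_iff]
  intro I
  induction I using Finset.strongInduction with
  | H I ih =>
    intro hI hsI
    have hsI' := (hs I hI).1 hsI
    obtain ⟨hA, hodd⟩ := hB.1 I hI
    have hev : s ∈ evPart G I ∨ ρ s ∈ evPart G I := by
      obtain ⟨a, n, hn, hnN, rfl⟩ := h.isTypeA_iff.1 hA
      rw [h.card_arc a hnN.le] at hodd
      obtain ⟨i, hi, rfl⟩ := mem_arc.1 hsI
      rw [← Equiv.Perm.mul_apply, ← pow_succ', h.pow_mem_arc (by omega) hnN.le] at hsI'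
      rw [← Equiv.Perm.mul_apply, ← pow_succ', h.pow_mem_evPart_iff a hodd hnN hi,
        h.pow_mem_evPart_iff a hodd hnN hsI', Nat.odd_add_one]
      exact em _
    obtain ⟨C, hCB, -, hCI, hcov⟩ := hB.2.2 I hI
    have key : ∀ x ∈ evPart G I, ∃ J ∈ C, x ∈ J := fun x hx => by
      simpa using hcov hx
    rcases hev with hx | hx
    · obtain ⟨J, hJ, hxJ⟩ := key _ hx
      exact ih J (hCI J hJ).1 (hCB hJ) hxJ
    · obtain ⟨J, hJ, hxJ⟩ := key _ hx
      exact ih J (hCI J hJ).1 (hCB hJ) ((hs J (hCB hJ)).2 hxJ)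

theorem isDepth_gNum (h : IsRotation G ρ N) (hB : B ∈ phi G) : IsDepth ρ fun s => gNum s B := by
  intro s
  by_cases hc : ∀ I ∈ B, s ∈ I ↔ ρ s ∈ I
  · left
    have := h.gNum_eq_zero hB hc
    exact ⟨this, (gNum_eq_of_not_cut hc).symm.trans this⟩
  · right
    push Not at hc
    obtain ⟨I, hI, ⟨h1, h2⟩ | ⟨h1, h2⟩⟩ := hc
    · exact Or.inr (h.gNum_end hB hI h1 h2)
    · exact Or.inl (h.gNum_start hB hI h1 h2)

/-- A member of `B` containing an end `a` of `I ∈ B` contains `I`, so the depth is least at the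
ends. -/
theorem gNum_le_of_cut (h : IsRotation G ρ N) (hB : B ∈ phi G) {I : Finset S} (hI : I ∈ B)
    {a a' x : S} (ha : a ∈ I) (ha' : a' ∉ I) (haa : a' = ρ a ∨ a = ρ a') (hx : x ∈ I) :
    gNum a B ≤ gNum x B := by
  refine Finset.card_le_card fun J hJ => ?_
  obtain ⟨hJB, haJ⟩ := Finset.mem_filter.1 hJ
  refine Finset.mem_filter.2 ⟨hJB, ?_⟩
  rcases hB.2.1 I hI J hJB with e | e | e | e
  · exact e ▸ hx
  · exact absurd haJ (Finset.disjoint_left.1 e.1 ha)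
  · exact e.1.1 hx
  · have ha'J : a' ∉ J := fun hh => ha' (e.1.1 hh)
    have : J = I := by
      rcases haa with rfl | rfl
      · exact h.unique_cut hB hJB hI (s := a) (by tauto) (by tauto)
      · exact h.unique_cut hB hJB hI (s := a') (by tauto) (by tauto)
    exact this ▸ hx

/-- A member of `B` runs from its start up to the first vertex of smaller depth. -/
theorem depth_of_mem (h : IsRotation G ρ N) (hB : B ∈ phi G) {a : S} {k : ℕ} (hk : 1 ≤ k)
    (hkN : k < N) (hI : arc ρ a k ∈ B) :
    (∀ i < k, gNum a B ≤ gNum ((ρ ^ i) a) B) ∧ gNum ((ρ ^ k) a) B < gNum a B := by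
  have ha : a ∈ arc ρ a k := mem_arc.2 ⟨0, hk, rfl⟩
  have hge : ∀ i < k, gNum a B ≤ gNum ((ρ ^ i) a) B := fun i hi =>
    h.gNum_le_of_cut hB hI ha (h.inv_not_mem_arc a hkN) (Or.inr (by simp)) (mem_arc.2 ⟨i, hi, rfl⟩)
  refine ⟨hge, ?_⟩
  have hb : (ρ ^ (k - 1)) a ∈ arc ρ a k := mem_arc.2 ⟨k - 1, by omega, rfl⟩
  have e : ρ ((ρ ^ (k - 1)) a) = (ρ ^ k) a := by
    rw [← Equiv.Perm.mul_apply, ← pow_succ', Nat.sub_add_cancel hk]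
  have hb' : (ρ ^ k) a ∉ arc ρ a k := by
    rw [h.pow_mem_arc hkN hkN.le]; omega
  have h1 := h.gNum_le_of_cut hB hI hb hb' (Or.inl e.symm) ha
  have h2 := h.gNum_end hB hI hb (e ▸ hb')
  rw [e] at h2
  omega

theorem subset_of_gNum_eq (h : IsRotation G ρ N) {B' : Finset (Finset S)} (hB : B ∈ phi G)
    (hB' : B' ∈ phi G) (hg : ∀ s, gNum s B = gNum s B') : B ⊆ B' := by
  intro I hI
  obtain ⟨a, k, hk, hkN, rfl⟩ := h.isTypeA_iff.1 (hB.1 I hI).1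
  have ha : a ∈ arc ρ a k := mem_arc.2 ⟨0, hk, rfl⟩
  have hst := h.gNum_start hB hI (h.inv_not_mem_arc a hkN) (by simpa using ha)
  rw [hg, hg, show ρ (ρ⁻¹ a) = a by simp] at hst
  obtain ⟨J, hJ, haJ, haJ'⟩ : ∃ J ∈ B', a ∈ J ∧ ρ⁻¹ a ∉ J := by
    by_contra! hc
    have : gNum a B' ≤ gNum (ρ⁻¹ a) B' :=
      Finset.card_le_card fun J hJ => by
        obtain ⟨h1, h2⟩ := Finset.mem_filter.1 hJ
        exact Finset.mem_filter.2 ⟨h1, hc J h1 h2⟩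
    omega
  obtain ⟨l, hl, hlN, -, rfl⟩ := h.exists_eq_arc (hB'.1 J hJ).1 haJ haJ'
  have h1 := h.depth_of_mem hB hk hkN hI
  have h2 := h.depth_of_mem hB' hl hlN hJ
  simp only [hg] at h1
  have e : k = l := by
    rcases lt_trichotomy k l with hlt | heq | hlt
    · have := h2.1 k hlt; omega
    · exact heq
    · have := h1.1 l hlt; omega
  rwa [e]

theorem eq_of_gNum_eq (h : IsRotation G ρ N) {B' : Finset (Finset S)} (hB : B ∈ phi G)
    (hB' : B' ∈ phi G) (hg : ∀ s, gNum s B = gNum s B') : B = B' :=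
  (h.subset_of_gNum_eq hB hB' hg).antisymm (h.subset_of_gNum_eq hB' hB fun s => (hg s).symm)

end IsRotation

end Depth

/-! ### The family with a prescribed depth function -/

section Level

variable {S : Type*} {G : SimpleGraph S} {ρ : Equiv.Perm S} {N : ℕ} {g : S → ℕ}

/-- `I` is a connected component of the full subgraph of `G` on `{x | d ≤ g x}`. -/
structure IsLevelComponent (G : SimpleGraph S) (g : S → ℕ) (d : ℕ) (I : Finset S) : Prop where
  nonempty : I.Nonempty
  preconnected : (G.induce (I : Set S)).Preconnected
  le : ∀ x ∈ I, d ≤ g x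
  closed : ∀ x ∈ I, ∀ y, G.Adj x y → d ≤ g y → y ∈ I

namespace IsLevelComponent

theorem exists_mem [Fintype S] {d : ℕ} {s : S} (hs : d ≤ g s) :
    ∃ I, IsLevelComponent G g d I ∧ s ∈ I := by
  classical
  let H := G.induce {x | d ≤ g x}
  let s' : {x | d ≤ g x} := ⟨s, hs⟩
  refine ⟨Finset.univ.filter fun x => ∃ hx : d ≤ g x, H.Reachable s' ⟨x, hx⟩, ⟨?_, ?_, ?_, ?_⟩, ?_⟩
  · exact ⟨s, by simp only [Finset.mem_filter_univ]; exact ⟨hs, SimpleGraph.Reachable.refl _⟩⟩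
  · set I := Finset.univ.filter fun x => ∃ hx : d ≤ g x, H.Reachable s' ⟨x, hx⟩ with hI
    have hmem : ∀ u : {x | d ≤ g x}, H.Reachable s' u → (u : S) ∈ I := fun u hu => by
      rw [hI, Finset.mem_filter_univ]; exact ⟨u.2, hu⟩
    have key : ∀ u v : {x | d ≤ g x}, H.Walk u v → ∀ (hu : H.Reachable s' u)
        (hv : H.Reachable s' v),
        (G.induce (I : Set S)).Reachable ⟨u, hmem u hu⟩ ⟨v, hmem v hv⟩ := by
      intro u v w
      induction w with
      | nil => exact fun _ _ => SimpleGraph.Reachable.refl _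
      | cons hadj _ ih =>
        intro hu hv
        have hw := hu.trans hadj.reachable
        exact (SimpleGraph.Adj.reachable (G := G.induce (I : Set S)) (u := ⟨_, hmem _ hu⟩)
          (v := ⟨_, hmem _ hw⟩) hadj).trans (ih hw hv)
    rintro ⟨x, hx⟩ ⟨y, hy⟩
    obtain ⟨hx', hxr⟩ := (Finset.mem_filter_univ _).1 hx
    obtain ⟨hy', hyr⟩ := (Finset.mem_filter_univ _).1 hy
    obtain ⟨w⟩ := hxr.symm.trans hyr
    exact key _ _ w hxr hyr
  · intro x hx
    exact ((Finset.mem_filter_univ _).1 hx).1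
  · intro x hx y hadj hy
    obtain ⟨hx', hxr⟩ := (Finset.mem_filter_univ _).1 hx
    refine (Finset.mem_filter_univ _).2 ⟨hy, hxr.trans (SimpleGraph.Adj.reachable ?_)⟩
    exact hadj
  · exact (Finset.mem_filter_univ _).2 ⟨hs, SimpleGraph.Reachable.refl _⟩

variable {d d' : ℕ} {I J : Finset S}

theorem subset_of_le (hI : IsLevelComponent G g d I) (hJ : IsLevelComponent G g d' J) (hd : d ≤ d')
    {x : S} (hxI : x ∈ I) (hxJ : x ∈ J) : J ⊆ I := fun _ hy =>
  mem_of_preconnected_induce (X := (I : Set S)) hJ.preconnected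
    (fun u _ v hv huv hu => hI.closed u hu v huv (hd.trans (hJ.le v hv))) hxJ hxI hy

theorem unique (hI : IsLevelComponent G g d I) (hJ : IsLevelComponent G g d J)
    {x : S} (hxI : x ∈ I) (hxJ : x ∈ J) : I = J :=
  (hJ.subset_of_le hI le_rfl hxJ hxI).antisymm (hI.subset_of_le hJ le_rfl hxI hxJ)

theorem spade [DecidableEq S] (hI : IsLevelComponent G g d I) (hJ : IsLevelComponent G g d' J)
    (hd : d ≤ d') (hdisj : Disjoint I J) : Spade G I J :=
  ⟨hdisj, isDisconnected_union hI.nonempty hJ.nonempty hdisj fun x hx y hy hadj =>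
    Finset.disjoint_left.1 hdisj (hI.closed x hx y hadj (hd.trans (hJ.le y hy))) hy⟩

theorem eq_of_boundary (hg : IsDepth ρ g) (hI : IsLevelComponent G g d I)
    (hρ : IsRotation G ρ N) {x y : S} (hx : x ∈ I) (hy : y ∉ I) (hxy : y = ρ x ∨ x = ρ y) :
    g x = d := by
  have hlt : g y < d := by
    by_contra! hle
    exact hy (hI.closed x hx y ((hρ.adj_iff _ _).2 hxy) hle)
  have hle := hI.le x hx
  rcases hxy with rfl | rfl
  · have := hg x; omega
  · have := hg y; omega

end IsLevelComponent

namespace IsRotation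

variable {d d' : ℕ} {I J : Finset S}

theorem not_mem_levelComponent {z : S} (hz : g z = 0) (hI : IsLevelComponent G g d I)
    (h1 : 1 ≤ d) : z ∉ I := fun hh => by
  have := hI.le z hh; omega

/-- The value `d` is attained on a component at level `d`, which therefore determines its level. -/
theorem exists_level_eq (h : IsRotation G ρ N) (hg : IsDepth ρ g) {z : S} (hz : g z = 0)
    (hI : IsLevelComponent G g d I) (h1 : 1 ≤ d) : ∃ x ∈ I, g x = d := by
  obtain ⟨a, ha, ha'⟩ := h.exists_start hI.nonempty (not_mem_levelComponent hz hI h1)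
  exact ⟨a, ha, hI.eq_of_boundary hg h ha ha' (Or.inr (by simp))⟩

variable [DecidableEq S]

/-- A component at level `d ≥ 1` is an arc with depth `d` at both ends, along which the parity of
the depth alternates. -/
theorem levelComponent_eq_arc (h : IsRotation G ρ N) (hg : IsDepth ρ g) {z : S} (hz : g z = 0)
    (hI : IsLevelComponent G g d I) (h1 : 1 ≤ d) :
    ∃ a k, 1 ≤ k ∧ k < N ∧ I = arc ρ a k ∧ g a = d ∧ g ((ρ ^ (k - 1)) a) = d ∧
      ∀ i < k, g ((ρ ^ i) a) % 2 = (d + i) % 2 := by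
  obtain ⟨a, ha, ha'⟩ := h.exists_start hI.nonempty (not_mem_levelComponent hz hI h1)
  obtain ⟨k, hk, hkN, hak, rfl⟩ := h.eq_arc_of_preconnected hI.preconnected ha ha'
  have hga := hI.eq_of_boundary hg h ha ha' (Or.inr (by simp))
  refine ⟨a, k, hk, hkN, rfl, hga, ?_, ?_⟩
  · refine hI.eq_of_boundary hg h (mem_arc.2 ⟨k - 1, by omega, rfl⟩) hak (Or.inl ?_)
    rw [← Equiv.Perm.mul_apply, ← pow_succ', Nat.sub_add_cancel hk]
  · intro i
    induction i with
    | zero => intro _; simp [hga]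
    | succ i ih =>
      intro hi
      have h2 := ih (by omega)
      have h3 := hI.le _ (mem_arc.2 ⟨i, by omega, rfl⟩)
      have h4 := hg ((ρ ^ i) a)
      rw [← Equiv.Perm.mul_apply, ← pow_succ'] at h4
      omega

theorem prec_of_levelComponent (h : IsRotation G ρ N) (hg : IsDepth ρ g) {z : S} (hz : g z = 0)
    (hI : IsLevelComponent G g d I) (h1 : 1 ≤ d) (hJ : IsLevelComponent G g d' J) (hd : d < d')
    {x : S} (hxI : x ∈ I) (hxJ : x ∈ J) : Prec G J I := by
  have hJI := hI.subset_of_le hJ hd.le hxI hxJ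
  obtain ⟨a, k, hk, hkN, hIk, hga, hgb, -⟩ := h.levelComponent_eq_arc hg hz hI h1
  have haI : a ∈ I := hIk ▸ mem_arc.2 ⟨0, hk, rfl⟩
  have haJ : a ∉ J := fun hh => by have := hJ.le a hh; omega
  have hbJ : (ρ ^ (k - 1)) a ∉ J := fun hh => by have := hJ.le _ hh; omega
  refine ⟨Finset.ssubset_iff_subset_ne.2 ⟨hJI, fun e => haJ (e ▸ haI)⟩, ?_⟩
  obtain ⟨a', l, hl, hlN, hJl, -⟩ := h.levelComponent_eq_arc hg hz hJ (by omega)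
  have ha' : a' ∈ arc ρ a k := hIk ▸ hJI (hJl ▸ mem_arc.2 ⟨0, hl, rfl⟩)
  obtain ⟨j, hj, rfl⟩ := mem_arc.1 ha'
  have hj1 : 1 ≤ j := by
    rw [Nat.one_le_iff_ne_zero]
    rintro rfl
    exact haJ (hJl ▸ mem_arc.2 ⟨0, hl, rfl⟩)
  have hjl : j + l < k := by
    by_contra! hle
    refine hbJ (hJl ▸ mem_arc.2 ⟨k - 1 - j, by omega, ?_⟩)
    rw [← Equiv.Perm.mul_apply, ← pow_add, Nat.sub_add_cancel (by omega)]
  obtain ⟨m, rfl⟩ := Nat.exists_eq_add_of_lt hjl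
  have hsplit : I \ J = arc ρ a j ∪ arc ρ ((ρ ^ (j + l)) a) (m + 1) := by
    have hd1 : Disjoint (arc ρ a j) J := hJl ▸ h.disjoint_arc a le_rfl (by omega)
    have hd2 : Disjoint (arc ρ a (j + l)) (arc ρ ((ρ ^ (j + l)) a) (m + 1)) :=
      h.disjoint_arc a le_rfl (by omega)
    rw [arc_add, ← hJl] at hd2
    rw [hIk, add_assoc, arc_add, arc_add, ← hJl]
    ext y
    have e1 : y ∈ arc ρ a j → y ∉ J := fun hy => Finset.disjoint_left.1 hd1 hy
    have e2 : y ∈ arc ρ a j ∪ J → y ∉ arc ρ ((ρ ^ (j + l)) a) (m + 1) := fun hy =>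
      Finset.disjoint_left.1 hd2 hy
    simp only [Finset.mem_sdiff, Finset.mem_union] at e2 ⊢
    tauto
  rw [hsplit]
  exact h.isDisconnected_arc_union a hj1 (by omega) (by omega) (by omega)

/-- Every depth function with a zero is the depth function of the family of connected components
of its superlevel sets. -/
theorem exists_phi_of_isDepth [Fintype S] (h : IsRotation G ρ N) (hg : IsDepth ρ g) {z : S}
    (hz : g z = 0) : ∃ B ∈ phi G, ∀ s, gNum s B = g s := by
  classical
  let B : Finset (Finset S) := Finset.univ.filter fun I => ∃ d, 1 ≤ d ∧ IsLevelComponent G g d I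
  have hB : ∀ {I}, I ∈ B ↔ ∃ d, 1 ≤ d ∧ IsLevelComponent G g d I := fun {I} =>
    Finset.mem_filter_univ I
  have hodd : ∀ I ∈ B, IsTypeAOdd G I := by
    intro I hI
    obtain ⟨d, h1, hId⟩ := hB.1 hI
    obtain ⟨a, k, hk, hkN, rfl, -, hgb, hpar⟩ := h.levelComponent_eq_arc hg hz hId h1
    refine ⟨h.isTypeA_arc a hk hkN, ?_⟩
    rw [h.card_arc a hkN.le, Nat.odd_iff]
    have := hpar (k - 1) (by omega)
    omega
  refine ⟨B, ⟨hodd, ?_, ?_⟩, ?_⟩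
  · have key : ∀ I J d d', IsLevelComponent G g d I → IsLevelComponent G g d' J → 1 ≤ d →
        d ≤ d' → Compatible G I J := by
      intro I J d d' hI hJ h1 hd
      by_cases hdisj : Disjoint I J
      · exact Or.inr (Or.inl (hI.spade hJ hd hdisj))
      · rw [Finset.not_disjoint_iff] at hdisj
        obtain ⟨x, hxI, hxJ⟩ := hdisj
        rcases hd.eq_or_lt with rfl | hlt
        · exact Or.inl (hI.unique hJ hxI hxJ)
        · exact Or.inr (Or.inr (Or.inr (h.prec_of_levelComponent hg hz hI h1 hJ hlt hxI hxJ)))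
    intro I hI J hJ
    obtain ⟨d, h1, hId⟩ := hB.1 hI
    obtain ⟨d', h1', hJd⟩ := hB.1 hJ
    rcases le_total d d' with hd | hd
    · exact key I J d d' hId hJd h1 hd
    · exact (key J I d' d hJd hId h1' hd).symm
  · intro I hI
    obtain ⟨d, h1, hId⟩ := hB.1 hI
    -- the components one level higher inside `I` cover the even positions of `I`
    refine ⟨Finset.univ.filter fun J => IsLevelComponent G g (d + 1) J ∧ ∃ x ∈ I, x ∈ J,
      ?_, ?_, ?_, ?_⟩
    · intro J hJ
      exact hB.2 ⟨d + 1, by omega, ((Finset.mem_filter_univ _).1 hJ).1⟩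
    · intro J hJ K hK hne
      change Disjoint J K
      by_contra hdisj
      rw [Finset.not_disjoint_iff] at hdisj
      obtain ⟨x, hxJ, hxK⟩ := hdisj
      exact hne (((Finset.mem_filter_univ _).1 hJ).1.unique ((Finset.mem_filter_univ _).1 hK).1
        hxJ hxK)
    · intro J hJ
      obtain ⟨hJ', x, hxI, hxJ⟩ := (Finset.mem_filter_univ _).1 hJ
      exact h.prec_of_levelComponent hg hz hId h1 hJ' (Nat.lt_succ_self d) hxI hxJ
    · intro s hs
      have hsI : s ∈ I := (mem_evPart.1 hs).1
      have hlt : d + 1 ≤ g s := by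
        have hodd' := (hodd I hI).2
        have hle := hId.le s hsI
        obtain ⟨a, k, hk, hkN, rfl, -, -, hpar⟩ := h.levelComponent_eq_arc hg hz hId h1
        rw [h.card_arc a hkN.le] at hodd'
        obtain ⟨i, hi, rfl⟩ := mem_arc.1 hsI
        have hio := (h.pow_mem_evPart_iff a hodd' hkN hi).1 hs
        rw [Nat.odd_iff] at hio
        have := hpar i hi
        omega
      obtain ⟨J, hJ, hsJ⟩ := IsLevelComponent.exists_mem (G := G) hlt
      exact Finset.mem_biUnion.2 ⟨J, (Finset.mem_filter_univ _).2 ⟨hJ, s, hsI, hsJ⟩, hsJ⟩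
  · intro s
    have hex : ∀ d ∈ Finset.Icc 1 (g s), ∃ I, IsLevelComponent G g d I ∧ s ∈ I := fun d hd =>
      IsLevelComponent.exists_mem (Finset.mem_Icc.1 hd).2
    choose! comp hcomp hmem using hex
    have hinj : ∀ d ∈ Finset.Icc 1 (g s), ∀ d' ∈ Finset.Icc 1 (g s), comp d = comp d' → d' ≤ d := by
      intro d hd d' hd' e
      obtain ⟨x, hx, hgx⟩ := h.exists_level_eq hg hz (hcomp d hd) (Finset.mem_Icc.1 hd).1
      exact hgx ▸ (hcomp d' hd').le x (e ▸ hx)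
    have := Finset.card_bij (s := Finset.Icc 1 (g s)) (t := B.filter fun I => s ∈ I)
      (fun d _ => comp d)
      (fun d hd => Finset.mem_filter.2
        ⟨hB.2 ⟨d, (Finset.mem_Icc.1 hd).1, hcomp d hd⟩, hmem d hd⟩)
      (fun d hd d' hd' e => le_antisymm (hinj d' hd' d hd e.symm) (hinj d hd d' hd' e))
      (fun I hI => by
        obtain ⟨hIB, hsI⟩ := Finset.mem_filter.1 hI
        obtain ⟨d, h1, hId⟩ := hB.1 hIB
        have hd : d ∈ Finset.Icc 1 (g s) := Finset.mem_Icc.2 ⟨h1, hId.le s hsI⟩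
        exact ⟨d, hd, (hcomp d hd).unique hId (hmem d hd) hsI⟩)
    rw [gNum, ← this, Nat.card_Icc]
    omega

end IsRotation

end Level

/-! ### Signed depths and words modulo complement -/

section Signed

/-- The bijection `0, 1, 2, 3, 4, … ↦ 0, 1, -1, 2, -2, …` from `ℕ` to `ℤ`. -/
def signedDepth (n : ℕ) : ℤ := if n % 2 = 0 then -(n / 2 : ℕ) else ((n + 1) / 2 : ℕ)

theorem signedDepth_injective : Function.Injective signedDepth := by
  intro m n e
  unfold signedDepth at e
  split_ifs at e <;> omega

theorem signedDepth_surjective : Function.Surjective signedDepth := by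
  intro z
  unfold signedDepth
  rcases le_or_gt z 0 with hz | hz
  · exact ⟨2 * (-z).toNat, by rw [if_pos (by omega)]; omega⟩
  · exact ⟨2 * z.toNat - 1, by rw [if_neg (by omega)]; omega⟩

/-- The steps allowed in a depth function are exactly those along which two successive signed
depths add up to `0` or `1`. -/
theorem signedDepth_add (m n : ℕ) :
    (signedDepth m + signedDepth n = 0 ∨ signedDepth m + signedDepth n = 1) ↔
      (m = 0 ∧ n = 0) ∨ n = m + 1 ∨ m = n + 1 := by
  unfold signedDepth
  split_ifs <;> omega

theorem cast_triangle (n : ℕ) : ((n * (n + 1) / 2 : ℕ) : ZMod 2) = (signedDepth n : ZMod 2) := by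
  unfold signedDepth
  rcases Nat.even_or_odd' n with ⟨k, rfl | rfl⟩
  · rw [if_pos (by omega), show 2 * k * (2 * k + 1) / 2 = k + 2 * (k * k) by
      rw [mul_assoc, Nat.mul_div_cancel_left _ two_pos]; ring, show 2 * k / 2 = k by omega]
    push_cast
    rw [show (2 : ZMod 2) = 0 from rfl, ZMod.neg_eq_self_mod_two]
    ring
  · rw [if_neg (by omega), show (2 * k + 1) * (2 * k + 1 + 1) / 2 = k + 1 + 2 * (k * (k + 1)) by
      rw [show (2 * k + 1) * (2 * k + 1 + 1) = 2 * ((2 * k + 1) * (k + 1)) by ring,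
        Nat.mul_div_cancel_left _ two_pos]; ring, show (2 * k + 1 + 1) / 2 = k + 1 by omega]
    push_cast
    rw [show (2 : ZMod 2) = 0 from rfl]
    ring

namespace IsRotation

variable {S : Type*} {G : SimpleGraph S} {ρ : Equiv.Perm S} {N : ℕ}

theorem eq_of_invariant (h : IsRotation G ρ N) {α : Type*} {f : S → α} (hf : ∀ s, f (ρ s) = f s)
    (s t : S) : f s = f t := by
  obtain ⟨i, -, rfl⟩ := h.exists_pow s t
  induction i with
  | zero => rfl
  | succ i ih => rw [pow_succ', Equiv.Perm.mul_apply, hf, ← ih]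

/-- On an odd cycle, the sums over the edges determine a function on the vertices. -/
theorem eq_of_add_rotate_eq (h : IsRotation G ρ N) (hN : Odd N) {u v : S → ℤ}
    (huv : ∀ s, u s + u (ρ s) = v s + v (ρ s)) : u = v := by
  funext s
  have key : ∀ i : ℕ, u ((ρ ^ i) s) - v ((ρ ^ i) s) = (-1) ^ i * (u s - v s) := by
    intro i
    induction i with
    | zero => simp
    | succ i ih =>
      have := huv ((ρ ^ i) s)
      rw [pow_succ' ρ, Equiv.Perm.mul_apply, pow_succ]
      linarith
  have := key N
  rw [h.pow_card, hN.neg_one_pow] at this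
  linarith

theorem exists_add_rotate_eq (h : IsRotation G ρ N) (hN : Odd N) {δ : S → ℤ}
    (hδ : ∀ s, Even (∑ i ∈ Finset.range N, δ ((ρ ^ i) s))) :
    ∃ u : S → ℤ, ∀ s, u s + u (ρ s) = δ s := by
  -- the alternating sum around the cycle is twice the solution
  let A : S → ℤ := fun s => ∑ i ∈ Finset.range N, (-1) ^ i * δ ((ρ ^ i) s)
  have hA : ∀ s, Even (A s) := by
    intro s
    have : Even (A s - ∑ i ∈ Finset.range N, δ ((ρ ^ i) s)) := by
      rw [← Finset.sum_sub_distrib]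
      refine Finset.even_sum _ fun i _ => ?_
      rcases neg_one_pow_eq_or ℤ i with e | e <;> rw [e]
      · simp
      · exact ⟨-δ ((ρ ^ i) s), by ring⟩
    simpa using this.add (hδ s)
  have hA2 : ∀ s, A s + A (ρ s) = 2 * δ s := by
    intro s
    have h1 := Finset.sum_range_succ (fun i => (-1 : ℤ) ^ i * δ ((ρ ^ i) s)) N
    have h2 := Finset.sum_range_succ' (fun i => (-1 : ℤ) ^ i * δ ((ρ ^ i) s)) N
    have h3 : ∑ i ∈ Finset.range N, (-1 : ℤ) ^ (i + 1) * δ ((ρ ^ (i + 1)) s) = -A (ρ s) := by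
      rw [← Finset.sum_neg_distrib]
      refine Finset.sum_congr rfl fun i _ => ?_
      rw [pow_succ, pow_succ, Equiv.Perm.mul_apply]
      ring
    rw [h3] at h2
    rw [h.pow_card, hN.neg_one_pow] at h1
    simp only [pow_zero, Equiv.Perm.one_apply] at h2
    change _ = A s + _ at h1
    linarith
  choose u hu using hA
  refine ⟨u, fun s => ?_⟩
  have := hA2 s
  rw [hu, hu] at this
  linarith

theorem exists_depth_eq_zero (h : IsRotation G ρ N) (hN : Odd N) {g : S → ℕ} (hg : IsDepth ρ g)
    (s : S) : ∃ z, g z = 0 := by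
  by_contra! hne
  have key : ∀ i : ℕ, g ((ρ ^ i) s) % 2 = (g s + i) % 2 := by
    intro i
    induction i with
    | zero => rfl
    | succ i ih =>
      have h1 := hg ((ρ ^ i) s)
      have h2 := hne ((ρ ^ i) s)
      rw [pow_succ', Equiv.Perm.mul_apply]
      omega
  have := key N
  rw [h.pow_card] at this
  rw [Nat.odd_iff] at hN
  omega

/-- Every word modulo `2` is, up to complement, the parity of the signed depths of a depth
function. -/
theorem exists_isDepth [Nonempty S] (h : IsRotation G ρ N) (hN : Odd N) (w : S → ZMod 2) :
    ∃ g : S → ℕ, IsDepth ρ g ∧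
      ∃ c : ZMod 2, ∀ s, ((g s * (g s + 1) / 2 : ℕ) : ZMod 2) = w s + c := by
  have hcast : ∀ x : ZMod 2, (((x.val : ℕ) : ℤ) : ZMod 2) = x := by decide
  have hval : ∀ x : ZMod 2, ((x.val : ℕ) : ℤ) = 0 ∨ ((x.val : ℕ) : ℤ) = 1 := by decide
  obtain ⟨u, hu⟩ := h.exists_add_rotate_eq hN (δ := fun s => ((w s + w (ρ s)).val : ℤ)) (by
    intro s
    rw [← ZMod.intCast_eq_zero_iff_even, Int.cast_sum]
    have : ∀ i ∈ Finset.range N, ((((w ((ρ ^ i) s) + w (ρ ((ρ ^ i) s))).val : ℕ) : ℤ) : ZMod 2) =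
        w ((ρ ^ (i + 1)) s) - w ((ρ ^ i) s) := by
      intro i _
      rw [hcast, pow_succ', Equiv.Perm.mul_apply, CharTwo.sub_eq_add, add_comm]
    rw [Finset.sum_congr rfl this, Finset.sum_range_sub (fun i => w ((ρ ^ i) s)), h.pow_card]
    simp)
  choose g hg using fun s => signedDepth_surjective (u s)
  refine ⟨g, fun s => ?_, ?_⟩
  · rw [← signedDepth_add, hg, hg, hu]
    exact hval _
  · let s₀ := Classical.arbitrary S
    refine ⟨(u s₀ : ZMod 2) - w s₀, fun s => ?_⟩
    have := h.eq_of_invariant (f := fun s => (u s : ZMod 2) - w s) (fun s => ?_) s s₀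
    · rw [cast_triangle, hg, ← this]
      ring
    · have h1 := congrArg (Int.cast : ℤ → ZMod 2) (hu s)
      rw [hcast, Int.cast_add] at h1
      change (u (ρ s) : ZMod 2) - w (ρ s) = u s - w s
      linear_combination h1 + CharTwo.add_self_eq_zero (w s) -
        CharTwo.add_self_eq_zero (u s : ZMod 2)

/-- A depth function is determined by the parities of its signed depths up to complement. -/
theorem depth_eq_of_triangle_eq (h : IsRotation G ρ N) (hN : Odd N) {g g' : S → ℕ}
    (hg : IsDepth ρ g) (hg' : IsDepth ρ g') {c : ZMod 2}
    (hc : ∀ s, ((g s * (g s + 1) / 2 : ℕ) : ZMod 2) = ((g' s * (g' s + 1) / 2 : ℕ) : ZMod 2) + c) :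
    g = g' := by
  have := h.eq_of_add_rotate_eq hN (u := fun s => signedDepth (g s))
    (v := fun s => signedDepth (g' s)) (by
      intro s
      have h1 := (signedDepth_add _ _).2 (hg s)
      have h2 := (signedDepth_add _ _).2 (hg' s)
      have h3 : ((signedDepth (g s) + signedDepth (g (ρ s)) : ℤ) : ZMod 2) =
          ((signedDepth (g' s) + signedDepth (g' (ρ s)) : ℤ) : ZMod 2) := by
        push_cast
        rw [← cast_triangle, ← cast_triangle, hc, hc, cast_triangle, cast_triangle,
          add_add_add_comm, CharTwo.add_self_eq_zero, add_zero]
      rw [← sub_eq_zero, ← Int.cast_sub, ZMod.intCast_eq_zero_iff_even, Int.even_iff] at h3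
      omega)
  funext s
  exact signedDepth_injective (congrFun this s)

end IsRotation

end Signed

/-! ### The quotient space -/

section Quotient

variable {S V : Type*} [Fintype S] [AddCommGroup V] [Module (ZMod 2) V]

theorem sum_smul_eBar (e : Module.Basis S (ZMod 2) V) (w : S → ZMod 2) :
    ∑ s, w s • eBar e s = (lineS e).mkQ (∑ s, w s • e s) := by
  simp [eBar, map_sum]

theorem exists_eq_sum_smul_eBar (e : Module.Basis S (ZMod 2) V) (x : VBar e) :
    ∃ w : S → ZMod 2, x = ∑ s, w s • eBar e s := by
  obtain ⟨v, rfl⟩ := (lineS e).mkQ_surjective x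
  exact ⟨e.repr v, by rw [sum_smul_eBar, e.sum_repr]⟩

/-- Words modulo `2` represent the same vector of the quotient exactly when they are equal up to
complement. -/
theorem sum_smul_eBar_eq_iff (e : Module.Basis S (ZMod 2) V) (v w : S → ZMod 2) :
    ∑ s, v s • eBar e s = ∑ s, w s • eBar e s ↔ ∃ c, ∀ s, v s = w s + c := by
  rw [sum_smul_eBar, sum_smul_eBar, Submodule.mkQ_apply, Submodule.mkQ_apply,
    Submodule.Quotient.eq, lineS, Submodule.mem_span_singleton]
  refine exists_congr fun c => ?_
  rw [eSum, Finset.smul_sum, ← Finset.sum_sub_distrib]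
  simp only [← sub_smul]
  rw [← sub_eq_zero, ← Finset.sum_sub_distrib]
  simp only [← sub_smul]
  constructor
  · intro h s
    have := Fintype.linearIndependent_iff.1 e.linearIndependent _ h s
    linear_combination -this
  · intro h
    refine Finset.sum_eq_zero fun s _ => ?_
    rw [h s]
    simp

theorem sum_eBar (e : Module.Basis S (ZMod 2) V) : ∑ s, eBar e s = 0 := by
  have := (sum_smul_eBar_eq_iff e (fun _ => 1) (fun _ => 0)).2 ⟨1, by simp⟩
  simpa using this

variable [DecidableEq S]

theorem eSum_compl (e : Module.Basis S (ZMod 2) V) (I : Finset S) :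
    eSum (eBar e) Iᶜ = eSum (eBar e) I := by
  have h1 : eSum (eBar e) I + eSum (eBar e) Iᶜ = 0 := by
    rw [eSum, eSum, Finset.sum_add_sum_compl, sum_eBar]
  have h2 : eSum (eBar e) I + eSum (eBar e) I = 0 := ZModModule.add_self _
  exact add_left_cancel (h1.trans h2.symm)

/-- The linear form `x ↦ x_s + x_{ρ s}` on the quotient space. -/
noncomputable def edgeForm (e : Module.Basis S (ZMod 2) V) (ρ : Equiv.Perm S) (s : S) :
    VBar e →ₗ[ZMod 2] ZMod 2 :=
  (lineS e).liftQ (e.coord s + e.coord (ρ s)) (by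
    rw [lineS, Submodule.span_singleton_le_iff_mem, LinearMap.mem_ker]
    simp only [eSum, map_sum, LinearMap.add_apply, Module.Basis.coord_apply,
      Module.Basis.repr_self, Finset.sum_add_distrib, Finsupp.single_apply]
    simp only [Finset.sum_ite_eq', Finset.mem_univ, if_true]
    rfl)

theorem edgeForm_eSum (e : Module.Basis S (ZMod 2) V) (ρ : Equiv.Perm S) (s : S) (I : Finset S) :
    edgeForm e ρ s (eSum (eBar e) I) = if (s ∈ I ↔ ρ s ∉ I) then 1 else 0 := by
  have h1 : edgeForm e ρ s (eSum (eBar e) I) =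
      (if s ∈ I then 1 else 0) + (if ρ s ∈ I then 1 else 0) := by
    simp only [eSum, map_sum, edgeForm, eBar, Submodule.mkQ_apply, Submodule.liftQ_apply,
      LinearMap.add_apply, Module.Basis.coord_apply, Module.Basis.repr_self,
      Finset.sum_add_distrib, Finsupp.single_apply, Finset.sum_ite_eq']
  rw [h1]
  by_cases hs : s ∈ I <;> by_cases ht : ρ s ∈ I <;> simp [hs, ht]
  rfl

/-! ### The bijection `ε̄` -/

/-- Numbering a chain of sets downwards from its largest member, `1 + 2 + ⋯ + n` is recovered
by counting, for each member, the members containing it. -/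
theorem sum_card_supersets_of_chain {α : Type*} [DecidableEq α] {F : Finset (Finset α)}
    (hF : ∀ I ∈ F, ∀ J ∈ F, I ⊆ J ∨ J ⊆ I) :
    ∑ I ∈ F, (F.filter fun J => I ⊆ J).card = F.card * (F.card + 1) / 2 := by
  have h1 : ∑ I ∈ F, (F.filter fun J => I ⊆ J).card = ∑ I ∈ F, (F.filter fun J => J ⊆ I).card := by
    simp only [Finset.card_filter]
    exact Finset.sum_comm
  have h2 : ∀ I ∈ F, (F.filter fun J => I ⊆ J).card + (F.filter fun J => J ⊆ I).card =
      F.card + 1 := by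
    intro I hI
    rw [← Finset.card_union_add_card_inter, ← Finset.filter_or, ← Finset.filter_and,
      Finset.filter_true_of_mem fun J hJ => hF I hI J hJ]
    congr 1
    rw [Finset.card_eq_one]
    refine ⟨I, ?_⟩
    ext J
    simp only [Finset.mem_filter, Finset.mem_singleton]
    constructor
    · exact fun h => h.2.2.antisymm h.2.1
    · rintro rfl
      exact ⟨hI, subset_rfl, subset_rfl⟩
  have h3 := Finset.sum_congr rfl h2
  rw [Finset.sum_add_distrib, ← h1, Finset.sum_const, smul_eq_mul] at h3
  omega

theorem eps_mem_LSub {W : Type*} [AddCommGroup W] [Module (ZMod 2) W] {G : SimpleGraph S}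
    (f : S → W) {B : Finset (Finset S)} (hB : B ∈ phi G) : eps f B ∈ LSub f B := by
  have hchain : ∀ s, gNum s B * (gNum s B + 1) / 2 =
      ∑ I ∈ B, if s ∈ I then (B.filter fun J => I ⊆ J).card else 0 := by
    intro s
    rw [← Finset.sum_filter, gNum, ← sum_card_supersets_of_chain]
    · refine Finset.sum_congr rfl fun I hI => ?_
      rw [Finset.filter_filter]
      congr 1
      exact Finset.filter_congr fun J _ =>
        ⟨fun h => h.2, fun h => ⟨h (Finset.mem_filter.1 hI).2, h⟩⟩
    · intro I hI J hJ
      obtain ⟨hI, hsI⟩ := Finset.mem_filter.1 hI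
      obtain ⟨hJ, hsJ⟩ := Finset.mem_filter.1 hJ
      rcases hB.2.1 I hI J hJ with h | h | h | h
      · exact Or.inl h.subset
      · exact absurd hsJ (Finset.disjoint_left.1 h.1 hsI)
      · exact Or.inl h.1.1
      · exact Or.inr h.1.1
  have key : eps f B = ∑ I ∈ B, (((B.filter fun J => I ⊆ J).card : ℕ) : ZMod 2) • eSum f I := by
    simp only [eps, hchain, Nat.cast_sum, Finset.sum_smul, eSum, Finset.smul_sum]
    rw [Finset.sum_comm]
    refine Finset.sum_congr rfl fun I _ => ?_
    rw [← Finset.sum_subset (Finset.subset_univ I)]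
    · exact Finset.sum_congr rfl fun s hs => by rw [if_pos hs]
    · intro s _ hs
      rw [if_neg hs, Nat.cast_zero, zero_smul]
  rw [key]
  exact Submodule.sum_mem _ fun I hI =>
    Submodule.smul_mem _ _ (Submodule.subset_span ⟨I, hI, rfl⟩)

theorem IsRotation.bijOn_eps [Nonempty S] {G : SimpleGraph S} {ρ : Equiv.Perm S} {N : ℕ}
    (h : IsRotation G ρ N) (hN : Odd N) (e : Module.Basis S (ZMod 2) V) :
    Set.BijOn (eps (eBar e)) (phi G) Set.univ := by
  refine ⟨Set.mapsTo_univ _ _, fun B hB B' hB' heq => ?_, fun x _ => ?_⟩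
  · obtain ⟨c, hc⟩ := (sum_smul_eBar_eq_iff e _ _).1 heq
    have := h.depth_eq_of_triangle_eq hN (h.isDepth_gNum hB) (h.isDepth_gNum hB') hc
    exact h.eq_of_gNum_eq hB hB' (congrFun this)
  · obtain ⟨w, rfl⟩ := exists_eq_sum_smul_eBar e x
    obtain ⟨g, hg, c, hc⟩ := h.exists_isDepth hN w
    obtain ⟨z, hz⟩ := h.exists_depth_eq_zero hN hg (Classical.arbitrary S)
    obtain ⟨B, hB, hBg⟩ := h.exists_phi_of_isDepth hg hz
    refine ⟨B, hB, (sum_smul_eBar_eq_iff e _ _).2 ⟨c, fun s => ?_⟩⟩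
    rw [hBg, hc]

end Quotient

/-! ### Arcs in the subspace of a family -/

section EpsPrime

variable {S V : Type*} [Fintype S] [DecidableEq S] [AddCommGroup V] [Module (ZMod 2) V]
  {G : SimpleGraph S} {ρ : Equiv.Perm S} {N : ℕ} {B : Finset (Finset S)}
  {e : Module.Basis S (ZMod 2) V}

namespace IsRotation

/-- On `L_B`, the linear forms of the two boundary edges of a member of `B` agree. -/
theorem edgeForm_eq_of_cut (h : IsRotation G ρ N) (hB : B ∈ phi G) {J : Finset S} (hJ : J ∈ B)
    {s t : S} (hs : s ∈ J ↔ ρ s ∉ J) (ht : t ∈ J ↔ ρ t ∉ J) {x : VBar e}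
    (hx : x ∈ LSub (eBar e) B) : edgeForm e ρ s x = edgeForm e ρ t x := by
  induction hx using Submodule.span_induction with
  | mem x hx =>
    obtain ⟨I, hI, rfl⟩ := hx
    rw [edgeForm_eSum, edgeForm_eSum]
    by_cases hIJ : I = J
    · subst hIJ
      rw [if_pos hs, if_pos ht]
    · rw [if_neg fun hh => hIJ (h.unique_cut hB hI hJ hh hs),
        if_neg fun hh => hIJ (h.unique_cut hB hI hJ hh ht)]
  | zero => rw [map_zero, map_zero]
  | add x y _ _ hx hy => rw [map_add, map_add, hx, hy]
  | smul c x _ hx => rw [map_smul, map_smul, hx]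

end IsRotation

theorem exists_cut_of_edgeForm_ne_zero {s : S} {x : VBar e} (hx : x ∈ LSub (eBar e) B)
    (hne : edgeForm e ρ s x ≠ 0) : ∃ J ∈ B, (s ∈ J ↔ ρ s ∉ J) := by
  by_contra! hc
  refine hne ?_
  induction hx using Submodule.span_induction with
  | mem x hx =>
    obtain ⟨I, hI, rfl⟩ := hx
    rw [edgeForm_eSum, if_neg]
    have := hc I hI
    tauto
  | zero => rw [map_zero]
  | add x y _ _ hx hy =>
    rw [map_add]
    by_cases h1 : edgeForm e ρ s x = 0
    · by_cases h2 : edgeForm e ρ s y = 0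
      · rw [h1, h2, add_zero]
      · exact absurd (hy h2) h2
    · exact absurd (hx h1) h1
  | smul c x _ hx =>
    rw [map_smul]
    by_cases h1 : edgeForm e ρ s x = 0
    · rw [h1, smul_zero]
    · exact absurd (hx h1) h1

namespace IsRotation

omit [Fintype S] in
/-- An arc has exactly two boundary edges. -/
theorem exists_cut_iff (h : IsRotation G ρ N) {I : Finset S} (hI : IsTypeA G I) :
    ∃ p q, p ≠ q ∧ ∀ s, (s ∈ I ↔ ρ s ∉ I) ↔ s = p ∨ s = q := by
  obtain ⟨a, k, hk, hkN, rfl⟩ := h.isTypeA_iff.1 hI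
  have hpow : ∀ i : ℕ, (ρ ^ (i + 1)) (ρ⁻¹ a) = (ρ ^ i) a := fun i => by
    rw [pow_succ, Equiv.Perm.mul_apply]; simp
  refine ⟨ρ⁻¹ a, (ρ ^ k) (ρ⁻¹ a), ?_, fun s => ?_⟩
  · have := h.pow_inj (s := ρ⁻¹ a) (i := 0) (j := k) (by omega) hkN
    rw [pow_zero, Equiv.Perm.one_apply] at this
    rw [Ne, this]
    omega
  · obtain ⟨i, hi, rfl⟩ := h.exists_pow (ρ⁻¹ a) s
    have h0 := h.pow_inj (s := ρ⁻¹ a) (i := i) (j := 0) (by omega) (by omega)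
    rw [pow_zero, Equiv.Perm.one_apply] at h0
    have h1 : ρ ((ρ ^ i) (ρ⁻¹ a)) = (ρ ^ i) a := by
      rw [← hpow, pow_succ', Equiv.Perm.mul_apply]
    rw [h0, h.pow_inj hi hkN, h1, h.pow_mem_arc hi hkN.le]
    cases i with
    | zero =>
      have := h.inv_not_mem_arc a hkN
      rw [pow_zero, Equiv.Perm.one_apply]
      exact ⟨fun _ => Or.inl rfl, fun _ => ⟨fun hh => absurd hh this, fun hh => absurd hk hh⟩⟩
    | succ i =>
      rw [hpow, h.pow_mem_arc (by omega) hkN.le]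
      omega

/-- The arcs whose vectors lie in `L_B` are the members of `B` and their complements: such an arc
has just two boundary edges, and shares them with the member of `B` having one of them. -/
theorem mem_or_compl_mem_of_eSum_mem (h : IsRotation G ρ N) (hB : B ∈ phi G) {I : Finset S}
    (hI : IsTypeA G I) (hL : eSum (eBar e) I ∈ LSub (eBar e) B) : I ∈ B ∨ Iᶜ ∈ B := by
  obtain ⟨p, q, hpq, hIc⟩ := h.exists_cut_iff hI
  have hp1 : edgeForm e ρ p (eSum (eBar e) I) = 1 := by
    rw [edgeForm_eSum, if_pos ((hIc p).2 (Or.inl rfl))]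
  obtain ⟨J, hJ, hpJ⟩ := exists_cut_of_edgeForm_ne_zero (ρ := ρ) hL (hp1 ▸ one_ne_zero)
  have hsub : ∀ s, (s ∈ J ↔ ρ s ∉ J) → (s ∈ I ↔ ρ s ∉ I) := by
    intro s hs
    have := h.edgeForm_eq_of_cut hB hJ hs hpJ hL
    rw [hp1, edgeForm_eSum] at this
    by_contra hc
    rw [if_neg hc] at this
    exact zero_ne_one this
  have hiff : ∀ s, (s ∈ J ↔ ρ s ∉ J) ↔ (s ∈ I ↔ ρ s ∉ I) := by
    refine fun s => ⟨hsub s, fun hs => ?_⟩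
    obtain ⟨p', q', hpq', hJc⟩ := h.exists_cut_iff (hB.1 J hJ).1
    have h1 := (hIc p').1 (hsub p' ((hJc p').2 (Or.inl rfl)))
    have h2 := (hIc q').1 (hsub q' ((hJc q').2 (Or.inr rfl)))
    rw [hJc]
    rw [hIc] at hs
    rcases hs with rfl | rfl <;> rcases h1 with rfl | rfl <;> rcases h2 with rfl | rfl <;> tauto
  have hinv : ∀ s, (ρ s ∈ I ↔ ρ s ∈ J) = (s ∈ I ↔ s ∈ J) := by
    intro s
    have := hiff s
    exact propext (by tauto)
  by_cases hpp : p ∈ I ↔ p ∈ J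
  · left
    have : I = J := Finset.ext fun s =>
      (h.eq_of_invariant (f := fun s => s ∈ I ↔ s ∈ J) hinv s p).mpr hpp
    rwa [this]
  · right
    have : Iᶜ = J := Finset.ext fun s => by
      have := h.eq_of_invariant (f := fun s => s ∈ I ↔ s ∈ J) hinv s p
      rw [Finset.mem_compl]
      rw [← this] at hpp
      tauto
    rwa [this]

theorem isTypeA_compl (h : IsRotation G ρ N) {I : Finset S} (hI : IsTypeA G I) :
    IsTypeA G Iᶜ := by
  obtain ⟨a, k, hk, hkN, rfl⟩ := h.isTypeA_iff.1 hI
  have huniv : arc ρ a N = Finset.univ :=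
    (Finset.card_eq_iff_eq_univ _).1 (by rw [h.card_arc a le_rfl, h.card_eq a])
  have : (arc ρ a k)ᶜ = arc ρ ((ρ ^ k) a) (N - k) := by
    obtain ⟨m, rfl⟩ := Nat.exists_eq_add_of_lt hkN
    have hd : Disjoint (arc ρ a k) (arc ρ ((ρ ^ k) a) (m + 1)) :=
      h.disjoint_arc a le_rfl (by omega)
    rw [show k + m + 1 - k = m + 1 by omega]
    rw [add_assoc, arc_add] at huniv
    refine (IsCompl.compl_eq ⟨hd, ?_⟩)
    rw [codisjoint_iff]
    exact huniv
  rw [this]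
  exact h.isTypeA_arc _ (by omega) (by omega)

theorem odd_card_compl_iff (h : IsRotation G ρ N) (hN : Odd N) {I : Finset S} (hI : IsTypeA G I) :
    Odd Iᶜ.card ↔ Even I.card := by
  obtain ⟨s, -⟩ := hI.nonempty
  have := Finset.card_add_card_compl I
  rw [h.card_eq s] at this
  rw [Nat.odd_iff, Nat.even_iff]
  rw [Nat.odd_iff] at hN
  omega

theorem mem_BT_iff (h : IsRotation G ρ N) (hB : B ∈ phi G) {t : S} {I : Finset S} :
    I ∈ BT G (eBar e) t B ↔ t ∉ I ∧ (I ∈ B ∨ Iᶜ ∈ B) := by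
  have hmem : I ∈ BT G (eBar e) t B ↔
      IsTypeA G I ∧ t ∉ I ∧ eSum (eBar e) I ∈ LSub (eBar e) B := by
    classical
    simp only [BT, Finset.mem_filter_univ]
  rw [hmem]
  constructor
  · rintro ⟨hI, ht, hL⟩
    exact ⟨ht, h.mem_or_compl_mem_of_eSum_mem hB hI hL⟩
  · rintro ⟨ht, hI | hI⟩
    · exact ⟨(hB.1 I hI).1, ht, Submodule.subset_span ⟨I, hI, rfl⟩⟩
    · refine ⟨?_, ht, ?_⟩
      · simpa using h.isTypeA_compl (hB.1 _ hI).1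
      · rw [← eSum_compl]
        exact Submodule.subset_span ⟨_, hI, rfl⟩

/-! ### Independence of the base point -/

theorem mem_BT_odd_iff (h : IsRotation G ρ N) (hN : Odd N) (hB : B ∈ phi G) {t : S}
    {I : Finset S} : I ∈ BT G (eBar e) t B ∧ IsTypeAOdd G I ↔ t ∉ I ∧ I ∈ B := by
  rw [h.mem_BT_iff hB]
  constructor
  · rintro ⟨⟨ht, hI | hI⟩, hodd⟩
    · exact ⟨ht, hI⟩
    · have := (h.odd_card_compl_iff hN hodd.1).1 (hB.1 _ hI).2
      exact absurd this (Nat.not_even_iff_odd.2 hodd.2)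
  · rintro ⟨ht, hI⟩
    exact ⟨⟨ht, Or.inl hI⟩, hB.1 I hI⟩

theorem mem_BT_even_iff (h : IsRotation G ρ N) (hN : Odd N) (hB : B ∈ phi G) {t : S}
    {I : Finset S} : I ∈ BT G (eBar e) t B ∧ IsTypeAEven G I ↔ t ∉ I ∧ Iᶜ ∈ B := by
  rw [h.mem_BT_iff hB]
  constructor
  · rintro ⟨⟨ht, hI | hI⟩, heven⟩
    · exact absurd heven.2 (Nat.not_even_iff_odd.2 (hB.1 I hI).2)
    · exact ⟨ht, hI⟩
  · rintro ⟨ht, hI⟩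
    have hA : IsTypeA G I := by simpa using h.isTypeA_compl (hB.1 _ hI).1
    exact ⟨⟨ht, Or.inr hI⟩, hA, (h.odd_card_compl_iff hN hA).1 (hB.1 _ hI).2⟩

/-- The members of `B^t` containing `s` are, for odd size, the members of `B` containing `s` but
not `t`, and, for even size, the complements of those containing `t` but not `s`; in the difference
the members containing both cancel. -/
theorem fNum_eq (h : IsRotation G ρ N) (hN : Odd N) (hB : B ∈ phi G) (s t : S) :
    fNum G (eBar e) t s B = (gNum s B : ℤ) - gNum t B - (gNum t B % 2 : ℕ) := by
  classical
  have hcompl : ∀ p : Finset S → Prop, ∀ [DecidablePred p],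
      ((BT G (eBar e) t B).filter fun I => IsTypeAEven G I ∧ p Iᶜ).card =
        (B.filter fun J => t ∈ J ∧ p J).card := by
    intro p _
    refine Finset.card_bij' (fun I _ => Iᶜ) (fun J _ => Jᶜ) (fun I hI => ?_) (fun J hJ => ?_)
      (fun I _ => compl_compl I) (fun J _ => compl_compl J)
    · obtain ⟨h1, h2, h3⟩ := Finset.mem_filter.1 hI
      obtain ⟨h4, h5⟩ := (h.mem_BT_even_iff hN hB).1 ⟨h1, h2⟩
      exact Finset.mem_filter.2 ⟨h5, by simpa using h4, h3⟩
    · obtain ⟨h1, h2, h3⟩ := Finset.mem_filter.1 hJ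
      obtain ⟨h4, h5⟩ := (h.mem_BT_even_iff (e := e) hN hB (t := t) (I := Jᶜ)).2
        ⟨by simpa using h2, by simpa using h1⟩
      exact Finset.mem_filter.2 ⟨h4, h5, by simpa using h3⟩
  have hodd : ((BT G (eBar e) t B).filter fun I => IsTypeAOdd G I ∧ s ∈ I).card =
      (B.filter fun J => s ∈ J ∧ t ∉ J).card := by
    congr 1
    ext I
    have := h.mem_BT_odd_iff (e := e) hN hB (t := t) (I := I)
    simp only [Finset.mem_filter]
    tauto
  have heven : ((BT G (eBar e) t B).filter fun I => IsTypeAEven G I ∧ s ∈ I).card =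
      (B.filter fun J => t ∈ J ∧ s ∉ J).card := by
    rw [← hcompl fun J => s ∉ J]
    simp
  have hall : ((BT G (eBar e) t B).filter fun I => IsTypeAEven G I).card = gNum t B := by
    have := hcompl fun _ => True
    simpa [gNum] using this
  have hs : gNum s B = (B.filter fun J => s ∈ J ∧ t ∈ J).card +
      (B.filter fun J => s ∈ J ∧ t ∉ J).card := by
    rw [gNum, ← Finset.card_filter_add_card_filter_not (fun J => t ∈ J), Finset.filter_filter,
      Finset.filter_filter]
  have ht : gNum t B = (B.filter fun J => s ∈ J ∧ t ∈ J).card +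
      (B.filter fun J => t ∈ J ∧ s ∉ J).card := by
    rw [gNum, ← Finset.card_filter_add_card_filter_not (fun J => s ∈ J), Finset.filter_filter,
      Finset.filter_filter]
    simp only [and_comm]
  have hf : fNum G (eBar e) t s B = ((B.filter fun J => s ∈ J ∧ t ∉ J).card : ℤ) -
      ((B.filter fun J => t ∈ J ∧ s ∉ J).card : ℤ) - (gNum t B % 2 : ℕ) := by
    rw [← hodd, ← heven, ← hall, fNum]
  rw [hf, hs, ht]
  push_cast
  ring

end IsRotation

/-- Shifting by an even number changes the parity of `n (n + 1) / 2` by a constant. -/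
theorem cast_triangle_sub (n m : ℕ) :
    ((((n : ℤ) - 2 * m) * ((n : ℤ) - 2 * m + 1) / 2 : ℤ) : ZMod 2) =
      ((n * (n + 1) / 2 : ℕ) : ZMod 2) + m := by
  obtain ⟨k, hk⟩ := Nat.even_mul_succ_self n
  have hk' : (n : ℤ) * (n + 1) = 2 * k := by exact_mod_cast hk.trans (two_mul k).symm
  rw [show ((n : ℤ) - 2 * m) * ((n : ℤ) - 2 * m + 1) = 2 * (k + 2 * (m * m - m * n - m) + m) by
    linear_combination hk', Int.mul_ediv_cancel_left _ two_ne_zero, hk, ← two_mul,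
    Nat.mul_div_cancel_left _ two_pos]
  push_cast
  rw [show (2 : ZMod 2) = 0 from rfl]
  ring

theorem IsRotation.epsPrime_eq_eps (h : IsRotation G ρ N) (hN : Odd N) (hB : B ∈ phi G) (t : S) :
    epsPrime G (eBar e) t B = eps (eBar e) B := by
  classical
  obtain ⟨m, hm⟩ : ∃ m, gNum t B + gNum t B % 2 = 2 * m :=
    ⟨(gNum t B + gNum t B % 2) / 2, by omega⟩
  have hf : ∀ s, fNum G (eBar e) t s B = (gNum s B : ℤ) - 2 * m := by
    intro s
    rw [h.fNum_eq hN hB]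
    omega
  -- the term missing from the sum over `S - {t}` would be zero, as `f_t = -r`
  have ht : ((fNum G (eBar e) t t B * (fNum G (eBar e) t t B + 1) / 2 : ℤ) : ZMod 2) = 0 := by
    have : fNum G (eBar e) t t B = 0 ∨ fNum G (eBar e) t t B = -1 := by
      rw [h.fNum_eq hN hB]
      omega
    rcases this with e | e <;> rw [e] <;> rfl
  have hsum : epsPrime G (eBar e) t B =
      ∑ s, ((fNum G (eBar e) t s B * (fNum G (eBar e) t s B + 1) / 2 : ℤ) : ZMod 2) • eBar e s := by
    rw [epsPrime, ← Finset.add_sum_erase _ _ (Finset.mem_univ t), ht, zero_smul, zero_add]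
  rw [hsum]
  refine (sum_smul_eBar_eq_iff e _ _).2 ⟨m, fun s => ?_⟩
  rw [hf, cast_triangle_sub]

end EpsPrime

/-! ### Graph automorphisms -/

section Automorphism

variable {S : Type*} [DecidableEq S] {G : SimpleGraph S}

/-- The isomorphism of full subgraphs on `I` and `γ I` given by an automorphism `γ`. -/
def induceImage (γ : G ≃g G) (I : Finset S) :
    G.induce (I : Set S) ≃g G.induce (I.image γ.toEquiv : Set S) :=
  γ.induce (by
    rw [Finset.coe_image]
    exact γ.injective.injOn.bijOn_image)

theorem isTypeAOdd_image (γ : G ≃g G) {I : Finset S} (hI : IsTypeAOdd G I) :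
    IsTypeAOdd G (I.image γ.toEquiv) := by
  obtain ⟨⟨m, hm, ⟨f⟩⟩, hodd⟩ := hI
  refine ⟨⟨m, hm, ⟨(induceImage γ I).symm.trans f⟩⟩, ?_⟩
  rwa [Finset.card_image_of_injective _ γ.toEquiv.injective]

theorem isDisconnected_image (γ : G ≃g G) {I : Finset S} (hI : IsDisconnected G I) :
    IsDisconnected G (I.image γ.toEquiv) := fun hc =>
  hI ((induceImage γ I).preconnected_iff.2 hc)

theorem spade_image (γ : G ≃g G) {I J : Finset S} (h : Spade G I J) :
    Spade G (I.image γ.toEquiv) (J.image γ.toEquiv) := by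
  refine ⟨(Finset.disjoint_image γ.injective).2 h.1, ?_⟩
  rw [← Finset.image_union]
  exact isDisconnected_image γ h.2

theorem prec_image (γ : G ≃g G) {I J : Finset S} (h : Prec G I J) :
    Prec G (I.image γ.toEquiv) (J.image γ.toEquiv) := by
  refine ⟨(Finset.image_ssubset_image γ.injective).2 h.1, ?_⟩
  rw [← Finset.image_sdiff _ _ γ.toEquiv.injective]
  exact isDisconnected_image γ h.2

theorem image_symm_image (γ : G ≃g G) (I : Finset S) :
    (I.image γ.toEquiv).image γ.symm.toEquiv = I := by
  have : γ.symm.toEquiv ∘ γ.toEquiv = id := funext γ.symm_apply_apply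
  rw [Finset.image_image, this, Finset.image_id]

theorem evPart_image_subset (γ : G ≃g G) (I : Finset S) :
    evPart G (I.image γ.toEquiv) ⊆ (evPart G I).image γ.toEquiv := by
  intro x hx
  obtain ⟨hxI, K, L, hK, hL, hKL, he⟩ := mem_evPart.1 hx
  obtain ⟨s, hs, rfl⟩ := Finset.mem_image.1 hxI
  refine Finset.mem_image_of_mem _ (mem_evPart.2 ⟨hs, K.image γ.symm.toEquiv,
    L.image γ.symm.toEquiv, isTypeAOdd_image γ.symm hK, isTypeAOdd_image γ.symm hL,
    spade_image γ.symm hKL, ?_⟩)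
  rw [← Finset.image_union, ← he, Finset.image_erase γ.symm.toEquiv.injective, image_symm_image]
  congr 1
  exact (γ.symm_apply_apply s).symm

theorem permR_symm_permR (γ : G ≃g G) (B : Finset (Finset S)) :
    permR γ.symm.toEquiv (permR γ.toEquiv B) = B := by
  have : (fun I : Finset S => I.image γ.symm.toEquiv) ∘
      (fun I : Finset S => I.image γ.toEquiv) = id :=
    funext (image_symm_image γ)
  rw [permR, permR, Finset.image_image, this, Finset.image_id]

theorem permR_mem_phi (γ : G ≃g G) {B : Finset (Finset S)} (hB : B ∈ phi G) :
    permR γ.toEquiv B ∈ phi G := by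
  obtain ⟨h0, h1, h2⟩ := hB
  refine ⟨?_, ?_, ?_⟩
  · intro I hI
    obtain ⟨I, hI', rfl⟩ := Finset.mem_image.1 hI
    exact isTypeAOdd_image γ (h0 I hI')
  · intro I hI J hJ
    obtain ⟨I, hI', rfl⟩ := Finset.mem_image.1 hI
    obtain ⟨J, hJ', rfl⟩ := Finset.mem_image.1 hJ
    rcases h1 I hI' J hJ' with h | h | h | h
    · exact Or.inl (h ▸ rfl)
    · exact Or.inr (Or.inl (spade_image γ h))
    · exact Or.inr (Or.inr (Or.inl (prec_image γ h)))
    · exact Or.inr (Or.inr (Or.inr (prec_image γ h)))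
  · intro I hI
    obtain ⟨I, hI', rfl⟩ := Finset.mem_image.1 hI
    obtain ⟨C, hCB, hCd, hCI, hcov⟩ := h2 I hI'
    refine ⟨permR γ.toEquiv C, Finset.image_subset_image hCB, ?_, ?_, ?_⟩
    · intro J hJ K hK hne
      obtain ⟨J, hJ', rfl⟩ := Finset.mem_image.1 hJ
      obtain ⟨K, hK', rfl⟩ := Finset.mem_image.1 hK
      exact (Finset.disjoint_image γ.injective).2 (hCd hJ' hK' fun h => hne (h ▸ rfl))
    · intro J hJ
      obtain ⟨J, hJ', rfl⟩ := Finset.mem_image.1 hJ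
      exact prec_image γ (hCI J hJ')
    · intro x hx
      obtain ⟨s, hs, rfl⟩ := Finset.mem_image.1 (evPart_image_subset γ I hx)
      obtain ⟨J, hJ, hsJ⟩ := Finset.mem_biUnion.1 (hcov hs)
      exact Finset.mem_biUnion.2 ⟨_, Finset.mem_image_of_mem _ hJ, Finset.mem_image_of_mem _ hsJ⟩

theorem bijOn_permR (γ : G ≃g G) : Set.BijOn (permR γ.toEquiv) (phi G) (phi G) :=
  Set.InvOn.bijOn (f' := permR γ.symm.toEquiv)
    ⟨fun B _ => permR_symm_permR γ B, fun B _ => permR_symm_permR γ.symm B⟩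
    (fun _ hB => permR_mem_phi γ hB) (fun _ hB => permR_mem_phi γ.symm hB)

theorem gNum_permR (σ : Equiv.Perm S) (B : Finset (Finset S)) (s : S) :
    gNum (σ s) (permR σ B) = gNum s B := by
  rw [gNum, permR, Finset.filter_image,
    Finset.card_image_of_injective _ (Finset.image_injective σ.injective), gNum]
  congr 1
  exact Finset.filter_congr fun I _ => σ.injective.mem_finset_image

theorem eps_permR [Fintype S] {V : Type*} [AddCommGroup V] [Module (ZMod 2) V]
    (e : Module.Basis S (ZMod 2) V) (σ : Equiv.Perm S) (B : Finset (Finset S)) :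
    eps (eBar e) (permR σ B) = permVBar e σ (eps (eBar e) B) := by
  have hperm : ∀ s, permVBar e σ (eBar e s) = eBar e (σ s) := fun s => by
    simp [permVBar, eBar]
  rw [eps, eps, map_sum, ← Equiv.sum_comp σ]
  refine Finset.sum_congr rfl fun s _ => ?_
  rw [map_smul, hperm, gNum_permR]

end Automorphism

theorem edgeGraph_barForm {S V : Type*} [Fintype S] [DecidableEq S] [AddCommGroup V]
    [Module (ZMod 2) V] {N : ℕ} {ω : LinearMap.BilinForm (ZMod 2) V}
    {e : Module.Basis S (ZMod 2) V} (h : IsAffineTypeA N ω e) :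
    edgeGraph h.barForm (eBar e) = edgeGraph ω e := rfl

end SympFam

theorem mainTheorem3 {S V : Type*} [Fintype S] [DecidableEq S] [AddCommGroup V]
    [Module (ZMod 2) V] (N : ℕ) (ω : LinearMap.BilinForm (ZMod 2) V)
    (e : Module.Basis S (ZMod 2) V) (h : IsAffineTypeA N ω e) :
    (∀ t : S, Set.BijOn (epsPrime (edgeGraph h.barForm (eBar e)) (eBar e) t)
        (phi (edgeGraph h.barForm (eBar e))) Set.univ) ∧
    (∀ t : S, ∀ B ∈ phi (edgeGraph h.barForm (eBar e)),
      epsPrime (edgeGraph h.barForm (eBar e)) (eBar e) t B = eps (eBar e) B) ∧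
    (∀ B ∈ phi (edgeGraph h.barForm (eBar e)), eps (eBar e) B ∈ LSub (eBar e) B) ∧
    (⋃ B ∈ phi (edgeGraph h.barForm (eBar e)), (LSub (eBar e) B : Set (VBar e))) = Set.univ ∧
    Set.BijOn (eps (eBar e)) (phi (edgeGraph h.barForm (eBar e))) Set.univ ∧
    (∀ γ : edgeGraph h.barForm (eBar e) ≃g edgeGraph h.barForm (eBar e),
      Set.BijOn (permR γ.toEquiv) (phi (edgeGraph h.barForm (eBar e)))
        (phi (edgeGraph h.barForm (eBar e))) ∧
      ∀ B ∈ phi (edgeGraph h.barForm (eBar e)),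
        eps (eBar e) (permR γ.toEquiv B) = permVBar e γ.toEquiv (eps (eBar e) B)) := by
  obtain ⟨φ⟩ := h.cycle
  rw [← edgeGraph_barForm h] at φ
  have h3 := h.three_le
  have : Nonempty S := ⟨φ.symm ⟨0, by omega⟩⟩
  obtain ⟨ρ, hρ⟩ := exists_isRotation h3 φ
  have hbij := hρ.bijOn_eps h.odd e
  have heq := fun t B (hB : B ∈ phi (edgeGraph h.barForm (eBar e))) =>
    hρ.epsPrime_eq_eps (e := e) h.odd hB t
  refine ⟨fun t => hbij.congr fun B hB => (heq t B hB).symm, heq,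
    fun B hB => eps_mem_LSub _ hB, ?_, hbij, fun γ => ⟨bijOn_permR γ, fun B _ => eps_permR e _ B⟩⟩
  refine Set.eq_univ_of_forall fun x => ?_
  obtain ⟨B, hB, rfl⟩ := hbij.surjOn (Set.mem_univ x)
  exact Set.mem_biUnion hB (eps_mem_LSub _ hB)
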